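/- Let $X$ be a real Hilbert space with norm $\|\cdot\|_X$, and let $\langle\cdot,\cdot\rangle_u$, $u\in X\setminus\{0\}$, be scalar products on $X$ with induced norms $\|\cdot\|_u$ such that: (M1) every $u\in X\setminus\{0\}$ has a neighborhood $U\subset X\setminus\{0\}$ and a constant $C>0$ with $\frac1C\|v\|_X\le\|v\|_{\tilde u}\le C\|v\|_X$ for all $\tilde u\in U$, $v\in X$; (M2) every $u\in X\setminus\{0\}$ has a neighborhood $U\subset X\setminus\{0\}$ and a constant $C>0$ with $|\langle v,w\rangle_{u_1}-\langle v,w\rangle_{u_2}|\le C\|u_1-u_2\|_X\|v\|_X\|w\|_X$ for all $u_1,u_2\in U$, $v,w\in X$. Let $G$ be a topological group acting linearly on $X$, written $g\ast u$, with (M3) $\langle g\ast v,g\ast w\rangle_{g\ast u}=\langle v,w\rangle_u$ for all $g\in G$, $u\in X\setminus\{0\}$, $v,w\in X$. Let $M\subset X\setminus\{0\}$ be a $C^{1,1}$-submanifold with $-M=M$ and $g\ast M=M$ for all $g\in G$, and assume that $\langle\cdot,\cdot\rangle_{-u}=\langle\cdot,\cdot\rangle_u$ for all $u\in M$. Let $\Phi\in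 C^{1,1}(M)$ be real-valued, even and $G$-invariant. For $u,v\in M$ let $d(u,v)\in[0,\infty]$ be the infimum of the lengths $\int_0^1\|\gamma'(s)\|_{\gamma(s)}\,ds$ of curves $\gamma\in C^1([0,1],M)$ with $\gamma(0)=u$, $\gamma(1)=v$ ($\inf\varnothing=\infty$). For $u\in M$ let $\nabla_u\Phi(u)\in T_uM$ be the vector with $\Phi'(u)w=\langle\nabla_u\Phi(u),w\rangle_u$ for all $w\in T_uM$. For $w\in M$ put $N(w)=\inf\{\|u\|_u+d(u,w):u\in M\}$. For $c\in\mathbb R$ and $\rho>0$ put $\Phi^c=\{u\in M:\Phi(u)\le c\}$, $K_c=\{u\in M:\Phi'(u)=0,\ \Phi(u)=c\}$ and $A_{c,\rho}=\{v\in M:\inf_{u\in K_c}d(v,u)<\rho\}$. The condition $(NCG)_c$ reads: for every sequence $(u_n)$ in $M$ with $\Phi(u_n)\to c$ and $\|\nabla_{u_n}\Phi(u_n)\|_{u_n}(1+N(u_n))\to0$ there are, after passing to a subsequence, $g_n\in G$ and $u\in M$ with $g_n\ast u_n\to u$ in $X$. Let $c\in\mathbb R$ and $\varepsilon_0>0$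 be such that $\Phi^{-1}([c-2\varepsilon_0,c+2\varepsilon_0])$ is complete with respect to $d$, and suppose that $(NCG)_c$ holds. Then for every $\rho>0$ there exist $\varepsilon\in(0,\varepsilon_0)$ and a continuous map $\eta:[0,1]\times M\to M$ such that: (i) $\eta(t,u)=u$ if $t=0$ or $u\notin\Phi^{-1}([c-2\varepsilon,c+2\varepsilon])$; (ii) for every $t\in[0,1]$, $\eta(t,\cdot)$ is a homeomorphism of $M$ and is odd, i.e. $\eta(t,-u)=-\eta(t,u)$ for all $u\in M$; (iii) $\eta(1,\Phi^{c+\varepsilon}\setminus A_{c,\rho})\subset\Phi^{c-\varepsilon}$; (iv) for every $u\in M$ the function $t\mapsto\Phi(\eta(t,u))$ is nonincreasing on $[0,1]$; (v) $\eta(t,g\ast u)=g\ast\eta(t,u)$ for all $u\in M$, $g\in G$, $t\in[0,1]$. -/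

import Mathlib

open Set Filter Topology
open scoped ENNReal

noncomputable section

namespace NCerami

variable {X : Type*} [NormedAddCommGroup X] [InnerProductSpace ℝ X]

/-- `f` is of class `C^{1,1}` on the open set `O`: it is continuously differentiable there, with
locally Lipschitz derivative. -/
def C11On {F : Type*} [NormedAddCommGroup F] [NormedSpace ℝ F] (f : X → F) (O : Set X) : Prop :=
  ContDiffOn ℝ 1 f O ∧ LocallyLipschitzOn O (fderiv ℝ f)

/-- `M` is a submanifold of `X` of class `C^{1,1}`: around each of its points there is a
`C^{1,1}`-diffeomorphism between open sets of `X` that carries `M` to a closed linear subspace. -/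
def IsC11Submanifold (M : Set X) : Prop :=
  ∀ u ∈ M, ∃ (ψ : OpenPartialHomeomorph X X) (E : Submodule ℝ X),
    IsClosed (E : Set X) ∧ u ∈ ψ.source ∧
    C11On ψ ψ.source ∧ C11On ψ.symm ψ.target ∧
    ∀ x ∈ ψ.source, x ∈ M ↔ ψ x ∈ E

/-- The tangent space `T_u M`, spanned by the velocities of the curves in `M` through `u`. (For a
submanifold `M` these velocities already form a linear subspace.) -/
def tangentSpaceAt (M : Set X) (u : X) : Submodule ℝ X :=
  Submodule.span ℝ
    {v | ∃ γ : ℝ → X, (∀ᶠ t in 𝓝 0, γ t ∈ M) ∧ γ 0 = u ∧ HasDerivAt γ v 0}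

/-- `Φ` restricts to a function of class `C^{1,1}` on `M`: near each point of `M` it agrees on `M`
with a `C^{1,1}`-function on an open set of `X`. Values of `Φ` outside `M` are irrelevant. -/
def IsC11FunctionOn (M : Set X) (Φ : X → ℝ) : Prop :=
  ∀ u ∈ M, ∃ (O : Set X) (Ψ : X → ℝ), IsOpen O ∧ u ∈ O ∧ C11On Ψ O ∧ EqOn Φ Ψ (O ∩ M)

/-- The derivative `Φ'(u)`, to be applied to tangent vectors `v ∈ T_u M`. (The functional
`fderivWithin ℝ Φ M u` on `X` is not unique, but its values on `T_u M` are, and there it is the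
derivative of `Φ` along curves in `M`.) -/
def derivOn (M : Set X) (Φ : X → ℝ) (u v : X) : ℝ := fderivWithin ℝ Φ M u v

/-- The critical set `K`. -/
def criticalSet (M : Set X) (Φ : X → ℝ) : Set X :=
  {u | u ∈ M ∧ ∀ v ∈ tangentSpaceAt M u, derivOn M Φ u v = 0}

/-- The critical set `K_c` at level `c`. -/
def criticalSetAt (M : Set X) (Φ : X → ℝ) (c : ℝ) : Set X :=
  {u | u ∈ criticalSet M Φ ∧ Φ u = c}

/-- `B u` is a scalar product on `X` for every `u ≠ 0`. -/
def IsScalarProductFamily (B : X → LinearMap.BilinForm ℝ X) : Prop :=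
  ∀ u, u ≠ 0 → (∀ v w, B u v w = B u w v) ∧ ∀ v, v ≠ 0 → 0 < B u v v

/-- The norm `‖v‖_u` induced by the scalar product `B u`. -/
def normAt (B : X → LinearMap.BilinForm ℝ X) (u v : X) : ℝ := √(B u v v)

/-- The norms `‖·‖_u` are locally uniformly equivalent to the norm of `X`. -/
def LocallyUniformlyEquivalent (B : X → LinearMap.BilinForm ℝ X) : Prop :=
  ∀ u : X, u ≠ 0 → ∃ U ∈ 𝓝 u, U ⊆ {0}ᶜ ∧ ∃ C : ℝ, 0 < C ∧
    ∀ u' ∈ U, ∀ v, 1 / C * ‖v‖ ≤ normAt B u' v ∧ normAt B u' v ≤ C * ‖v‖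

/-- The scalar products `B u` depend in a locally Lipschitz way on `u`. -/
def LocallyLipschitzFamily (B : X → LinearMap.BilinForm ℝ X) : Prop :=
  ∀ u : X, u ≠ 0 → ∃ U ∈ 𝓝 u, U ⊆ {0}ᶜ ∧ ∃ C : ℝ, 0 < C ∧
    ∀ u₁ ∈ U, ∀ u₂ ∈ U, ∀ v w, |B u₁ v w - B u₂ v w| ≤ C * ‖u₁ - u₂‖ * ‖v‖ * ‖w‖

/-- The length of a curve `γ` over the parameter interval `[0,1]`. -/
def curveLength (B : X → LinearMap.BilinForm ℝ X) (γ : ℝ → X) : ℝ≥0∞ :=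
  ∫⁻ s in Icc (0 : ℝ) 1, ENNReal.ofReal (normAt B (γ s) (derivWithin γ (Icc 0 1) s))

/-- The length metric `d` on `M`: the infimum of the lengths of the `C¹`-curves in `M` that join the
two points, and `∞` if there are none. -/
def lengthDist (B : X → LinearMap.BilinForm ℝ X) (M : Set X) (u v : X) : ℝ≥0∞ :=
  ⨅ (γ : ℝ → X) (_ : ContDiffOn ℝ 1 γ (Icc 0 1) ∧ MapsTo γ (Icc 0 1) M ∧ γ 0 = u ∧ γ 1 = v),
    curveLength B γ

/-- `dist_M(v, A)`, which is `∞` for empty `A`. -/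
def distToSet (B : X → LinearMap.BilinForm ℝ X) (M : Set X) (v : X) (A : Set X) : ℝ≥0∞ :=
  ⨅ u ∈ A, lengthDist B M v u

/-- The neighbourhood `A_{c,ρ}` of `K_c`. -/
def criticalNhd (B : X → LinearMap.BilinForm ℝ X) (M : Set X) (Φ : X → ℝ) (c ρ : ℝ) : Set X :=
  {v | v ∈ M ∧ distToSet B M v (criticalSetAt M Φ c) < ENNReal.ofReal ρ}

/-- The set `S ⊆ M` is complete with respect to the length metric of `M`. -/
def IsLengthComplete (B : X → LinearMap.BilinForm ℝ X) (M S : Set X) : Prop :=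
  ∀ u : ℕ → X, (∀ n, u n ∈ S) →
    (∀ δ : ℝ≥0∞, 0 < δ → ∃ n₀, ∀ m ≥ n₀, ∀ n ≥ n₀, lengthDist B M (u m) (u n) < δ) →
    ∃ a ∈ S, Tendsto (fun n => lengthDist B M (u n) a) atTop (𝓝 0)

/-- `w` is the gradient `∇_u Φ(u)`: the tangent vector at `u` that represents `Φ'(u)` on `T_u M` by
the scalar product `B u`. -/
def IsGradientAt (B : X → LinearMap.BilinForm ℝ X) (M : Set X) (Φ : X → ℝ) (u w : X) : Prop :=
  w ∈ tangentSpaceAt M u ∧ ∀ v ∈ tangentSpaceAt M u, derivOn M Φ u v = B u w v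

/-- The function `N` on `M`. -/
def nFun (B : X → LinearMap.BilinForm ℝ X) (M : Set X) (w : X) : ℝ≥0∞ :=
  ⨅ u ∈ M, ENNReal.ofReal (normAt B u u) + lengthDist B M u w

/-- `(u_n)` is an `N`-Cerami sequence in `M` at the level `c`. -/
def IsNCeramiSeq (B : X → LinearMap.BilinForm ℝ X) (M : Set X) (Φ : X → ℝ) (c : ℝ)
    (u : ℕ → X) : Prop :=
  (∀ n, u n ∈ M) ∧ Tendsto (fun n => Φ (u n)) atTop (𝓝 c) ∧
  ∃ w : ℕ → X, (∀ n, IsGradientAt B M Φ (u n) (w n)) ∧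
    Tendsto (fun n => ENNReal.ofReal (normAt B (u n) (w n)) * (1 + nFun B M (u n))) atTop (𝓝 0)

/-- The `N`-Cerami condition relative to the group `G` at level `c` in `M`. -/
def NCGCondition (G : Type*) [SMul G X] (B : X → LinearMap.BilinForm ℝ X) (M : Set X)
    (Φ : X → ℝ) (c : ℝ) : Prop :=
  ∀ u : ℕ → X, IsNCeramiSeq B M Φ c u →
    ∃ k : ℕ → ℕ, StrictMono k ∧ ∃ (g : ℕ → G), ∃ a ∈ M,
      Tendsto (fun n => g n • u (k n)) atTop (𝓝 a)

end NCerami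

end

/-! The deformation is the time-one flow of a field `-κ ∇Φ` on `M`, with a scalar factor `κ = 2ε ·
χ₁(Φ) · χ₂(dist(·, K_c)) / max(‖∇Φ‖², (δ/(1+N))²)`. Here `χ₁` cuts off outside the level strip `|Φ -
c| < 2ε` and `χ₂` cuts off near `K_c`. Since the data are `C^{1,1}`, the gradient itself is locally
Lipschitz (`locallyLipschitzOn_gradOn`), so no pseudo-gradient is needed; the maximum keeps `κ`
locally Lipschitz at critical points too.

The Cerami condition enters twice, by contradiction. Some `δ > 0` bounds `‖∇Φ‖ (1+N)` from below
near the level `c` at distance at least `ρ/2` from `K_c` (`exists_cerami_lower_bound`), because a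
violating sequence would, after translation by `G`, converge to a point of `K_c`, while `d`, `N`,
`‖∇Φ‖` and `K_c` are invariant. Likewise `N` is bounded on `K_c` (`exists_nFun_le`).

From `ab ≤ max(a², b²)` the speed of the field is at most `(2ε/δ)(1+N)`. As `N` is 1-Lipschitz for
`d`, it stays bounded along a flow line in bounded time, so the line is `d`-Cauchy there.
Completeness of the strip then supplies an endpoint from which the line can be continued
(`hasEndpoints`), and a line that meets the complement of the strip is constant. Hence the flow is
global. Uniqueness of flow lines yields the group law, thus homeomorphisms, and equivariance under
`G` and under `-id`.

For the descent: within `ρ` of `K_c` the speed is at most `(2ε/δ)(1+R+ρ)`, where `R` bounds `N` on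
`K_c`. For small `ε` a line starting outside `A_{c,ρ}` therefore remains `ρ/2` away from `K_c` in
unit time (`half_le_truncDist_along`). There `Φ` decreases at the exact rate `2ε` as long as `|Φ -
c| ≤ ε`, which carries it from `c + ε` to `c - ε` (`apply_flow_one_le`). -/

noncomputable section

namespace NCerami
variable {X : Type*} [NormedAddCommGroup X] [InnerProductSpace ℝ X]

/-! ### Scalar products -/

lemma normAt_nonneg (B : X → LinearMap.BilinForm ℝ X) (u v : X) : 0 ≤ normAt B u v :=
  Real.sqrt_nonneg _

lemma normAt_smul (B : X → LinearMap.BilinForm ℝ X) (u : X) (a : ℝ) (v : X) :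
    normAt B u (a • v) = |a| * normAt B u v := by
  unfold normAt
  rw [show B u (a • v) (a • v) = a * a * B u v v by simp [mul_assoc],
    Real.sqrt_mul (mul_self_nonneg a), Real.sqrt_mul_self_eq_abs]

lemma normAt_zero (B : X → LinearMap.BilinForm ℝ X) (u : X) : normAt B u 0 = 0 := by
  simp [normAt]

lemma IsScalarProductFamily.self_nonneg {B : X → LinearMap.BilinForm ℝ X}
    (hB : IsScalarProductFamily B) {u : X} (hu : u ≠ 0) (v : X) : 0 ≤ B u v v := by
  rcases eq_or_ne v 0 with rfl | hv
  · simp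
  · exact ((hB u hu).2 v hv).le

lemma IsScalarProductFamily.normAt_sq {B : X → LinearMap.BilinForm ℝ X}
    (hB : IsScalarProductFamily B) {u : X} (hu : u ≠ 0) (v : X) : normAt B u v ^ 2 = B u v v :=
  Real.sq_sqrt (hB.self_nonneg hu v)

lemma IsScalarProductFamily.abs_apply_le {B : X → LinearMap.BilinForm ℝ X}
    (hB : IsScalarProductFamily B) {u : X} (hu : u ≠ 0) (v w : X) :
    |B u v w| ≤ normAt B u v * normAt B u w := by
  have h := (B u).apply_mul_apply_le_of_forall_zero_le (hB.self_nonneg hu) v w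
  rw [(hB u hu).1 w v] at h
  unfold normAt
  rw [← Real.sqrt_mul (hB.self_nonneg hu v), ← Real.sqrt_mul_self_eq_abs]
  exact Real.sqrt_le_sqrt h

/-! ### The length metric -/

lemma lengthDist_le_curveLength (B : X → LinearMap.BilinForm ℝ X) {M : Set X} {γ : ℝ → X}
    (hγ : ContDiffOn ℝ 1 γ (Icc 0 1)) (hM : MapsTo γ (Icc 0 1) M) :
    lengthDist B M (γ 0) (γ 1) ≤ curveLength B γ :=
  iInf₂_le γ ⟨hγ, hM, rfl, rfl⟩

lemma exists_curve_of_lengthDist_lt {B : X → LinearMap.BilinForm ℝ X} {M : Set X} {u v : X}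
    {r : ℝ≥0∞} (h : lengthDist B M u v < r) :
    ∃ γ : ℝ → X, ContDiffOn ℝ 1 γ (Icc 0 1) ∧ MapsTo γ (Icc 0 1) M ∧ γ 0 = u ∧ γ 1 = v ∧
      curveLength B γ < r := by
  simp only [lengthDist, iInf_lt_iff] at h
  obtain ⟨γ, ⟨h1, h2, h3, h4⟩, h5⟩ := h
  exact ⟨γ, h1, h2, h3, h4, h5⟩

lemma lengthDist_self (B : X → LinearMap.BilinForm ℝ X) {M : Set X} {u : X} (hu : u ∈ M) :
    lengthDist B M u u = 0 := by
  refine le_antisymm ?_ bot_le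
  refine (lengthDist_le_curveLength B (γ := fun _ => u) contDiffOn_const fun _ _ => hu).trans ?_
  simp [curveLength, normAt_zero]

/-- A curve of speed at most `L` over `[a,b]` has length at most `L (b - a)`; the curve may be
traversed in either direction. -/
lemma lengthDist_le_of_speed_le (B : X → LinearMap.BilinForm ℝ X) {M : Set X} {γ γ' : ℝ → X}
    {a b L : ℝ} (hd : ∀ t ∈ uIcc a b, HasDerivAt γ (γ' t) t) (hc : ContinuousOn γ' (uIcc a b))
    (hM : ∀ t ∈ uIcc a b, γ t ∈ M) (hL : ∀ t ∈ uIcc a b, normAt B (γ t) (γ' t) ≤ L) :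
    lengthDist B M (γ a) (γ b) ≤ ENNReal.ofReal (L * |b - a|) := by
  set f : ℝ → ℝ := fun s => a + s * (b - a) with hf
  have hfm : MapsTo f (Icc 0 1) (uIcc a b) := by
    intro s hs
    rw [uIcc_eq_union]
    rcases le_total a b with h | h
    · left; constructor <;> simp only [hf] <;> nlinarith [hs.1, hs.2]
    · right; constructor <;> simp only [hf] <;> nlinarith [hs.1, hs.2]
  have hfd : ∀ s, HasDerivAt f (b - a) s := fun s =>
    (hasDerivAt_mul_const (b - a)).const_add a
  have hgd : ∀ s ∈ Icc (0 : ℝ) 1, HasDerivAt (γ ∘ f) ((b - a) • γ' (f s)) s := fun s hs =>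
    (hd _ (hfm hs)).scomp s (hfd s)
  have hgw : ∀ s ∈ Icc (0 : ℝ) 1, derivWithin (γ ∘ f) (Icc 0 1) s = (b - a) • γ' (f s) :=
    fun s hs => (hgd s hs).hasDerivWithinAt.derivWithin
      (uniqueDiffOn_Icc zero_lt_one s hs)
  have hfc : Continuous f := by fun_prop
  have hC1 : ContDiffOn ℝ 1 (γ ∘ f) (Icc 0 1) := by
    rw [contDiffOn_one_iff_derivWithin (uniqueDiffOn_Icc zero_lt_one)]
    refine ⟨fun s hs => (hgd s hs).differentiableAt.differentiableWithinAt, ?_⟩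
    refine ContinuousOn.congr ?_ hgw
    exact ContinuousOn.const_smul (hc.comp hfc.continuousOn hfm) _
  have := lengthDist_le_curveLength B hC1 fun s hs => hM _ (hfm hs)
  have h0 : (γ ∘ f) 0 = γ a := by simp [hf]
  have h1 : (γ ∘ f) 1 = γ b := by simp [hf]
  rw [h0, h1] at this
  refine this.trans ?_
  unfold curveLength
  calc _ ≤ ∫⁻ _ in Icc (0 : ℝ) 1, ENNReal.ofReal (L * |b - a|) := by
        refine MeasureTheory.setLIntegral_mono measurable_const fun s hs => ?_
        rw [hgw s hs, normAt_smul, mul_comm]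
        exact ENNReal.ofReal_le_ofReal
          (mul_le_mul_of_nonneg_right (hL _ (hfm hs)) (abs_nonneg _))
    _ = _ := by simp

/-- Change of variables for monotone or antitone `f`, which need not be injective: stretches where
`f` is constant contribute nothing. This admits reparametrisations that rest at an endpoint. The
integrand is the speed of `γ ∘ f` by the chain rule. -/
lemma curveLength_eq_lintegral_of_reparam (B : X → LinearMap.BilinForm ℝ X) (γ : ℝ → X)
    {f f' : ℝ → ℝ} {a b : ℝ} (hd : ∀ s ∈ Icc a b, HasDerivWithinAt f (f' s) (Icc a b) s)
    (him : f '' Icc a b = Icc 0 1)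
    (hf : (MonotoneOn f (Icc a b) ∧ ∀ s ∈ Icc a b, 0 ≤ f' s) ∨
      (AntitoneOn f (Icc a b) ∧ ∀ s ∈ Icc a b, f' s ≤ 0)) :
    curveLength B γ = ∫⁻ s in Icc a b,
      ENNReal.ofReal (normAt B (γ (f s)) (f' s • derivWithin γ (Icc 0 1) (f s))) := by
  unfold curveLength
  nth_rw 1 [← him]
  rcases hf with ⟨hf, h0⟩ | ⟨hf, h0⟩
  · rw [MeasureTheory.lintegral_image_eq_lintegral_deriv_mul_of_monotoneOn measurableSet_Icc hd hf]
    refine MeasureTheory.setLIntegral_congr_fun measurableSet_Icc fun s hs => ?_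
    simp only [normAt_smul, abs_of_nonneg (h0 s hs), ENNReal.ofReal_mul (h0 s hs)]
  · rw [MeasureTheory.lintegral_image_eq_lintegral_deriv_mul_of_antitoneOn measurableSet_Icc hd hf]
    refine MeasureTheory.setLIntegral_congr_fun measurableSet_Icc fun s hs => ?_
    simp only [normAt_smul, abs_of_nonpos (h0 s hs),
      ENNReal.ofReal_mul (neg_nonneg.2 (h0 s hs))]

lemma lengthDist_comm_le (B : X → LinearMap.BilinForm ℝ X) (M : Set X) (u v : X) :
    lengthDist B M v u ≤ lengthDist B M u v := by
  refine le_of_forall_gt fun r hr => ?_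
  obtain ⟨γ, hγ, hM, rfl, rfl, hlt⟩ := exists_curve_of_lengthDist_lt hr
  set f : ℝ → ℝ := fun s => 1 - s with hf
  have hfm : MapsTo f (Icc 0 1) (Icc 0 1) := fun s hs =>
    ⟨sub_nonneg.2 hs.2, sub_le_self _ hs.1⟩
  have hfd : ∀ s, HasDerivAt f (-1) s := fun s => by
    simpa using! (hasDerivAt_id s).const_sub 1
  have him : f '' Icc 0 1 = Icc 0 1 :=
    Subset.antisymm hfm.image_subset fun s hs => ⟨f s, hfm hs, by simp [hf]⟩
  have h := lengthDist_le_curveLength B (γ := γ ∘ f)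
    (hγ.comp (by fun_prop) hfm) (hM.comp hfm)
  simp only [Function.comp, hf, sub_zero, sub_self] at h
  refine (h.trans_eq ?_).trans_lt hlt
  rw [curveLength_eq_lintegral_of_reparam B γ (fun s _ => (hfd s).hasDerivWithinAt) him
    (Or.inr ⟨fun _ _ _ _ h => sub_le_sub_left h 1, fun _ _ => by norm_num⟩)]
  refine MeasureTheory.setLIntegral_congr_fun measurableSet_Icc fun s hs => ?_
  have := ((hγ.differentiableOn one_ne_zero _ (hfm hs)).hasDerivWithinAt).scomp s
    (hfd s).hasDerivWithinAt hfm
  change ENNReal.ofReal (normAt B (γ (f s)) (derivWithin (γ ∘ f) (Icc 0 1) s)) = _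
  rw [this.derivWithin (uniqueDiffOn_Icc zero_lt_one s hs)]

lemma lengthDist_comm (B : X → LinearMap.BilinForm ℝ X) (M : Set X) (u v : X) :
    lengthDist B M u v = lengthDist B M v u :=
  le_antisymm (lengthDist_comm_le B M v u) (lengthDist_comm_le B M u v)

/-- Concatenating two `C¹` curves leaves a corner. Slowing both down to rest at the junction with a
smooth transition removes it and leaves the lengths unchanged. -/
lemma lengthDist_triangle (B : X → LinearMap.BilinForm ℝ X) (M : Set X) (u v w : X) :
    lengthDist B M u w ≤ lengthDist B M u v + lengthDist B M v w := by
  refine le_of_forall_gt fun r hr => ?_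
  obtain ⟨r₁, hr₁, r₂, hr₂, hlt⟩ := ENNReal.exists_add_lt_of_add_lt hr
  obtain ⟨γ₁, hγ₁, hM₁, rfl, h₁₁, hlt₁⟩ := exists_curve_of_lengthDist_lt hr₁
  obtain ⟨γ₂, hγ₂, hM₂, h₂₀, rfl, hlt₂⟩ := exists_curve_of_lengthDist_lt hr₂
  have hθ : ContDiff ℝ 1 Real.smoothTransition := Real.smoothTransition.contDiff
  have hθd : ∀ x, HasDerivAt Real.smoothTransition (deriv Real.smoothTransition x) x := fun x =>
    (hθ.differentiable one_ne_zero x).hasDerivAt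
  have hθm : ∀ x, Real.smoothTransition x ∈ Icc (0 : ℝ) 1 := fun x =>
    ⟨Real.smoothTransition.nonneg x, Real.smoothTransition.le_one x⟩
  have hθp : ∀ x, 0 ≤ deriv Real.smoothTransition x := fun x =>
    Real.smoothTransition.monotone.deriv_nonneg
  set f₁ : ℝ → ℝ := fun s => Real.smoothTransition (2 * s) with hf₁
  set f₂ : ℝ → ℝ := fun s => Real.smoothTransition (2 * s - 1) with hf₂
  have hd₁ : ∀ s, HasDerivAt f₁ (deriv Real.smoothTransition (2 * s) * 2) s := fun s =>
    (hθd _).comp s (by simpa using (hasDerivAt_id s).const_mul 2)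
  have hd₂ : ∀ s, HasDerivAt f₂ (deriv Real.smoothTransition (2 * s - 1) * 2) s := fun s =>
    (hθd _).comp s (by simpa using ((hasDerivAt_id s).const_mul 2).sub_const 1)
  have hm₁ : Monotone f₁ := fun s t h => Real.smoothTransition.monotone (by linarith)
  have hm₂ : Monotone f₂ := fun s t h => Real.smoothTransition.monotone (by linarith)
  have hone₁ : ∀ s, 1 / 2 ≤ s → f₁ s = 1 := fun s hs =>
    Real.smoothTransition.one_of_one_le (by linarith)
  have hzero₂ : ∀ s, s ≤ 1 / 2 → f₂ s = 0 := fun s hs =>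
    Real.smoothTransition.zero_of_nonpos (by linarith)
  have hz₁ : f₁ 0 = 0 := Real.smoothTransition.zero_of_nonpos (by norm_num)
  have ho₂ : f₂ 1 = 1 := Real.smoothTransition.one_of_one_le (by norm_num)
  have him₁ : f₁ '' Icc 0 (1 / 2) = Icc 0 1 := by
    rw [ContinuousOn.image_Icc_of_monotoneOn (by norm_num)
      (fun s _ => (hd₁ s).continuousAt.continuousWithinAt) (hm₁.monotoneOn _), hz₁,
      hone₁ _ le_rfl]
  have him₂ : f₂ '' Icc (1 / 2) 1 = Icc 0 1 := by
    rw [ContinuousOn.image_Icc_of_monotoneOn (by norm_num)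
      (fun s _ => (hd₂ s).continuousAt.continuousWithinAt) (hm₂.monotoneOn _), ho₂,
      hzero₂ _ le_rfl]
  -- On each half one of the two summands equals `v` and cancels, so the sum traverses `γ₁`, then
  -- `γ₂`, and is visibly `C¹` without any gluing.
  set γ : ℝ → X := fun s => γ₁ (f₁ s) + γ₂ (f₂ s) - v with hγdef
  have hγl : ∀ s, s ≤ 1 / 2 → γ s = γ₁ (f₁ s) := fun s hs => by
    simp [hγdef, hzero₂ s hs, h₂₀]
  have hγr : ∀ s, 1 / 2 ≤ s → γ s = γ₂ (f₂ s) := fun s hs => by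
    simp [hγdef, hone₁ s hs, h₁₁]
  have hC : ContDiffOn ℝ 1 γ (Icc 0 1) := by
    have e₁ : ContDiffOn ℝ 1 (γ₁ ∘ f₁) (Icc 0 1) :=
      hγ₁.comp (hθ.comp (by fun_prop)).contDiffOn fun s _ => hθm _
    have e₂ : ContDiffOn ℝ 1 (γ₂ ∘ f₂) (Icc 0 1) :=
      hγ₂.comp (hθ.comp (by fun_prop)).contDiffOn fun s _ => hθm _
    exact (e₁.add e₂).sub contDiffOn_const
  have hMγ : MapsTo γ (Icc 0 1) M := fun s _ => by
    rcases le_total s (1 / 2) with h | h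
    · rw [hγl s h]; exact hM₁ (hθm _)
    · rw [hγr s h]; exact hM₂ (hθm _)
  have h := lengthDist_le_curveLength B hC hMγ
  rw [hγl 0 (by norm_num), hγr 1 (by norm_num), hz₁, ho₂] at h
  refine h.trans_lt (lt_of_eq_of_lt ?_ ((ENNReal.add_lt_add hlt₁ hlt₂).trans hlt))
  rw [curveLength_eq_lintegral_of_reparam B γ₁ (fun s _ => (hd₁ s).hasDerivWithinAt) him₁
      (Or.inl ⟨hm₁.monotoneOn _, fun s _ => mul_nonneg (hθp _) (by norm_num)⟩),
    curveLength_eq_lintegral_of_reparam B γ₂ (fun s _ => (hd₂ s).hasDerivWithinAt) him₂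
      (Or.inl ⟨hm₂.monotoneOn _, fun s _ => mul_nonneg (hθp _) (by norm_num)⟩)]
  unfold curveLength
  rw [← Icc_union_Ioc_eq_Icc (a := (0 : ℝ)) (b := 1 / 2) (c := 1) (by norm_num) (by norm_num),
    MeasureTheory.lintegral_union measurableSet_Ioc
      (disjoint_left.2 fun s hs hs' => absurd hs.2 (not_le.2 hs'.1)),
    MeasureTheory.restrict_Ioc_eq_restrict_Icc,
    Icc_union_Ioc_eq_Icc (by norm_num) (by norm_num),
    ← MeasureTheory.restrict_Ioo_eq_restrict_Icc, ← MeasureTheory.restrict_Ioo_eq_restrict_Icc]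
  congr 1
  · refine MeasureTheory.setLIntegral_congr_fun measurableSet_Ioo fun s hs => ?_
    have hs1 : Icc (0 : ℝ) 1 ∈ 𝓝 s := Icc_mem_nhds hs.1 (by linarith [hs.2])
    have hd := ((hγ₁.differentiableOn one_ne_zero _ (hθm (2 * s))).hasDerivWithinAt).scomp s
      (hd₁ s).hasDerivWithinAt (fun s _ => hθm (2 * s) : MapsTo f₁ univ _)
    have hev : γ =ᶠ[𝓝 s] γ₁ ∘ f₁ := by
      filter_upwards [Iio_mem_nhds hs.2] with t ht using hγl t ht.le
    rw [derivWithin_of_mem_nhds hs1, hev.deriv_eq, hγl s hs.2.le,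
      (hasDerivWithinAt_univ.1 hd).deriv]
  · refine MeasureTheory.setLIntegral_congr_fun measurableSet_Ioo fun s hs => ?_
    have hs1 : Icc (0 : ℝ) 1 ∈ 𝓝 s := Icc_mem_nhds (by linarith [hs.1]) hs.2
    have hd := ((hγ₂.differentiableOn one_ne_zero _ (hθm (2 * s - 1))).hasDerivWithinAt).scomp s
      (hd₂ s).hasDerivWithinAt (fun s _ => hθm (2 * s - 1) : MapsTo f₂ univ _)
    have hev : γ =ᶠ[𝓝 s] γ₂ ∘ f₂ := by
      filter_upwards [Ioi_mem_nhds hs.1] with t ht using hγr t (le_of_lt ht)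
    rw [derivWithin_of_mem_nhds hs1, hev.deriv_eq, hγr s hs.1.le,
      (hasDerivWithinAt_univ.1 hd).deriv]

/-- Convergence in the length metric implies convergence in the norm of `X`. -/
lemma exists_norm_sub_lt_of_lengthDist_lt {B : X → LinearMap.BilinForm ℝ X}
    (hB : LocallyUniformlyEquivalent B) (M : Set X) {a : X} (ha : a ≠ 0) {r : ℝ} (hr : 0 < r) :
    ∃ δ : ℝ, 0 < δ ∧ ∀ v, lengthDist B M v a < ENNReal.ofReal δ → ‖v - a‖ < r := by
  obtain ⟨U, hU, -, C, hC, hUC⟩ := hB a ha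
  obtain ⟨r₀, hr₀, hr₀U⟩ := Metric.mem_nhds_iff.1 hU
  set r₁ := min r r₀ with hr₁
  have hr₁p : 0 < r₁ := lt_min hr hr₀
  refine ⟨r₁ / C, by positivity, fun v hv => ?_⟩
  obtain ⟨γ, hγ, hM, rfl, rfl, hlt⟩ := exists_curve_of_lengthDist_lt hv
  by_contra! hcon
  -- After the last time `s₁` in `S` the curve lies in `U`, where `‖·‖ ≤ C ‖·‖_{γ(s)}`. The
  -- remaining piece then has norm length below `C · (r₁ / C) = r₁`, too short to reach `γ 1` from
  -- distance `r₁`.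
  set S := Icc (0 : ℝ) 1 ∩ {s | r₁ ≤ ‖γ s - γ 1‖} with hS
  have hcont : ContinuousOn (fun s => ‖γ s - γ 1‖) (Icc (0 : ℝ) 1) :=
    (hγ.continuousOn.sub continuousOn_const).norm
  have hSc : IsCompact S :=
    isCompact_Icc.of_isClosed_subset
      (hcont.preimage_isClosed_of_isClosed isClosed_Icc isClosed_Ici) inter_subset_left
  have hSn : S.Nonempty := ⟨0, left_mem_Icc.2 zero_le_one, (min_le_left _ _).trans hcon⟩
  obtain ⟨s₁, ⟨hs₁, hs₁r⟩, hmax⟩ := hSc.exists_isMaxOn hSn continuousOn_id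
  have hin : ∀ s ∈ Ioc s₁ 1, γ s ∈ U := by
    intro s hs
    by_contra hns
    have : s ∈ S := ⟨⟨hs₁.1.trans hs.1.le, hs.2⟩, by
      by_contra hlt
      exact hns (hr₀U (mem_ball_iff_norm.2 ((not_le.1 hlt).trans_le (min_le_right _ _))))⟩
    exact absurd (hmax this) (not_le.2 hs.1)
  have key : ‖γ 1 - γ s₁‖ₑ ≤ ENNReal.ofReal C * curveLength B γ := by
    refine (enorm_sub_le_lintegral_deriv_of_contDiffOn_Icc
      (hγ.mono (Icc_subset_Icc_left hs₁.1)) hs₁.2).trans ?_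
    unfold curveLength
    rw [← MeasureTheory.lintegral_const_mul' _ _ ENNReal.ofReal_ne_top,
      ← MeasureTheory.restrict_Ioo_eq_restrict_Icc, ← MeasureTheory.restrict_Ioo_eq_restrict_Icc]
    refine le_trans ?_ (MeasureTheory.lintegral_mono_set (Ioo_subset_Ioo_left hs₁.1))
    refine MeasureTheory.setLIntegral_mono' measurableSet_Ioo fun s hs => ?_
    rw [derivWithin_of_mem_nhds (Icc_mem_nhds (hs₁.1.trans_lt hs.1) hs.2),
      ← ENNReal.ofReal_mul hC.le, ← ofReal_norm]
    refine ENNReal.ofReal_le_ofReal ?_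
    have := (hUC _ (hin s ⟨hs.1, hs.2.le⟩) (deriv γ s)).1
    rwa [one_div, inv_mul_le_iff₀ hC] at this
  have h2 : ‖γ 1 - γ s₁‖ₑ < ENNReal.ofReal r₁ := by
    refine key.trans_lt ?_
    calc _ < ENNReal.ofReal C * ENNReal.ofReal (r₁ / C) :=
          ENNReal.mul_lt_mul_right (by simpa using hC) ENNReal.ofReal_ne_top hlt
      _ = _ := by rw [← ENNReal.ofReal_mul hC.le, mul_div_cancel₀ _ hC.ne']
  rw [← ofReal_norm, ENNReal.ofReal_lt_ofReal_iff hr₁p, norm_sub_rev] at h2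
  exact absurd hs₁r (not_le.2 h2)

end NCerami

namespace NCerami
variable {X : Type*} [NormedAddCommGroup X] [InnerProductSpace ℝ X]

/-! ### Local Lipschitz estimates -/

lemma hasDerivAt_add_smul (x e : X) (t : ℝ) : HasDerivAt (fun s : ℝ => x + s • e) e t := by
  have := ((hasDerivAt_id t).smul_const e).const_add x
  rwa [one_smul] at this

lemma locallyLipschitzOn_iff {F : Type*} [NormedAddCommGroup F] {M : Set X} {f : X → F} :
    LocallyLipschitzOn M f ↔ ∀ u ∈ M, ∃ U ∈ 𝓝 u, ∃ K : ℝ, 0 < K ∧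
      ∀ v ∈ U ∩ M, ∀ w ∈ U ∩ M, ‖f v - f w‖ ≤ K * ‖v - w‖ := by
  constructor
  · intro h u hu
    obtain ⟨K, t, ht, hK⟩ := h hu
    obtain ⟨U, hU, hUt⟩ := mem_nhdsWithin_iff_exists_mem_nhds_inter.1 ht
    refine ⟨U, hU, K + 1, by positivity, fun v hv w hw => ?_⟩
    have := hK.dist_le_mul v (hUt hv) w (hUt hw)
    rw [dist_eq_norm, dist_eq_norm] at this
    nlinarith [norm_nonneg (v - w)]
  · intro h u hu
    obtain ⟨U, hU, K, hK, hUK⟩ := h u hu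
    refine ⟨K.toNNReal, U ∩ M, inter_mem (mem_nhdsWithin_of_mem_nhds hU) self_mem_nhdsWithin, ?_⟩
    refine LipschitzOnWith.of_dist_le_mul fun v hv w hw => ?_
    rw [dist_eq_norm, dist_eq_norm, Real.coe_toNNReal _ hK.le]
    exact hUK v hv w hw

lemma C11On.exists_bounds {F : Type*} [NormedAddCommGroup F] [NormedSpace ℝ F] {f : X → F}
    {O : Set X} (hf : C11On f O) (hO : IsOpen O) {x : X} (hx : x ∈ O) :
    ∃ r > 0, ∃ K > 0, Metric.ball x r ⊆ O ∧
      (∀ y ∈ Metric.ball x r, HasFDerivAt f (fderiv ℝ f y) y) ∧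
      (∀ y ∈ Metric.ball x r, ‖fderiv ℝ f y‖ ≤ K) ∧
      (∀ y ∈ Metric.ball x r, ∀ z ∈ Metric.ball x r,
        ‖fderiv ℝ f y - fderiv ℝ f z‖ ≤ K * ‖y - z‖) ∧
      (∀ y ∈ Metric.ball x r, ∀ z ∈ Metric.ball x r, ‖f y - f z‖ ≤ K * ‖y - z‖) := by
  obtain ⟨U, hU, K, hK, hUK⟩ := locallyLipschitzOn_iff.1 hf.2 x hx
  have hc : ContinuousAt (fderiv ℝ f) x :=
    (hf.2.continuousOn x hx).continuousAt (hO.mem_nhds hx)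
  have hb : ∀ᶠ y in 𝓝 x, ‖fderiv ℝ f y‖ < ‖fderiv ℝ f x‖ + 1 :=
    hc.norm.eventually_lt_const (lt_add_one _)
  obtain ⟨r, hr, hrb⟩ := Metric.eventually_nhds_iff_ball.1
    (hb.and (Filter.Eventually.and (hO.mem_nhds hx : ∀ᶠ y in 𝓝 x, y ∈ O)
      (hU : ∀ᶠ y in 𝓝 x, y ∈ U)))
  have hd : ∀ y ∈ Metric.ball x r, HasFDerivAt f (fderiv ℝ f y) y := fun y hy =>
    ((hf.1.differentiableOn one_ne_zero y (hrb y hy).2.1).differentiableAt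
      (hO.mem_nhds (hrb y hy).2.1)).hasFDerivAt
  refine ⟨r, hr, K + ‖fderiv ℝ f x‖ + 1, by positivity, fun y hy => (hrb y hy).2.1, hd,
    fun y hy => ?_, fun y hy z hz => ?_, fun y hy z hz => ?_⟩
  · linarith [(hrb y hy).1]
  · refine (hUK y ⟨(hrb y hy).2.2, (hrb y hy).2.1⟩ z ⟨(hrb z hz).2.2, (hrb z hz).2.1⟩).trans ?_
    gcongr
    linarith [norm_nonneg (fderiv ℝ f x)]
  · refine (convex_ball x r).norm_image_sub_le_of_norm_hasFDerivWithin_le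
      (fun w hw => (hd w hw).hasFDerivWithinAt) (fun w hw => ?_) hz hy
    linarith [(hrb w hw).1]

/-! ### Charts and tangent spaces -/

/-- A chart of the submanifold `M`: a `C^{1,1}`-diffeomorphism between open sets of `X` that carries
`M` to the closed subspace `E`. -/
structure C11Chart (M : Set X) where
  /-- the diffeomorphism -/
  ψ : OpenPartialHomeomorph X X
  /-- the model subspace -/
  E : Submodule ℝ X
  isClosed_E : IsClosed (E : Set X)
  c11 : C11On ψ ψ.source
  c11_symm : C11On ψ.symm ψ.target
  mem_iff : ∀ x ∈ ψ.source, x ∈ M ↔ ψ x ∈ E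

lemma IsC11Submanifold.exists_chart {M : Set X} (hM : IsC11Submanifold M) {u : X} (hu : u ∈ M) :
    ∃ c : C11Chart M, u ∈ c.ψ.source := by
  obtain ⟨ψ, E, h1, h2, h3, h4, h5⟩ := hM u hu
  exact ⟨⟨ψ, E, h1, h3, h4, h5⟩, h2⟩

namespace C11Chart
variable {M : Set X} (c : C11Chart M)

lemma hasFDerivAt {x : X} (hx : x ∈ c.ψ.source) : HasFDerivAt c.ψ (fderiv ℝ c.ψ x) x :=
  ((c.c11.1.differentiableOn one_ne_zero x hx).differentiableAt
    (c.ψ.open_source.mem_nhds hx)).hasFDerivAt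

lemma hasFDerivAt_symm {y : X} (hy : y ∈ c.ψ.target) :
    HasFDerivAt c.ψ.symm (fderiv ℝ c.ψ.symm y) y :=
  ((c.c11_symm.1.differentiableOn one_ne_zero y hy).differentiableAt
    (c.ψ.open_target.mem_nhds hy)).hasFDerivAt

lemma fderiv_symm_fderiv {x : X} (hx : x ∈ c.ψ.source) (v : X) :
    fderiv ℝ c.ψ.symm (c.ψ x) (fderiv ℝ c.ψ x v) = v := by
  have h1 := (c.hasFDerivAt_symm (c.ψ.map_source hx)).comp x (c.hasFDerivAt hx)
  have h2 : HasFDerivAt (c.ψ.symm ∘ c.ψ) (ContinuousLinearMap.id ℝ X) x :=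
    (hasFDerivAt_id x).congr_of_eventuallyEq (c.ψ.eventually_left_inverse hx)
  exact congrArg (fun L => L v) (h1.unique h2)

lemma fderiv_fderiv_symm {x : X} (hx : x ∈ c.ψ.source) (v : X) :
    fderiv ℝ c.ψ x (fderiv ℝ c.ψ.symm (c.ψ x) v) = v := by
  have hy := c.ψ.map_source hx
  have h0 : c.ψ.symm (c.ψ x) = x := c.ψ.left_inv hx
  have h1 := HasFDerivAt.comp (c.ψ x) (h0.symm ▸ c.hasFDerivAt hx) (c.hasFDerivAt_symm hy)
  have h2 : HasFDerivAt (c.ψ ∘ c.ψ.symm) (ContinuousLinearMap.id ℝ X) (c.ψ x) :=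
    (hasFDerivAt_id _).congr_of_eventuallyEq (c.ψ.eventually_right_inverse hy)
  have h3 := congrArg (fun L => L v) (h1.unique h2)
  rwa [h0] at h3

lemma mem_of_mem_target {y : X} (hy : y ∈ c.ψ.target) (hE : y ∈ c.E) : c.ψ.symm y ∈ M := by
  rw [c.mem_iff _ (c.ψ.map_target hy), c.ψ.right_inv hy]
  exact hE

/-- The difference quotients of `ψ ∘ γ` lie in `E`, and `E` is closed. -/
lemma fderiv_mem_of_curve {x : X} (hx : x ∈ c.ψ.source) {γ : ℝ → X} {v : X}
    (hM : ∀ᶠ t in 𝓝 0, γ t ∈ M) (h0 : γ 0 = x) (hd : HasDerivAt γ v 0) :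
    fderiv ℝ c.ψ x v ∈ c.E := by
  have h1 : HasDerivAt (c.ψ ∘ γ) (fderiv ℝ c.ψ x v) 0 :=
    HasFDerivAt.comp_hasDerivAt 0 (h0.symm ▸ c.hasFDerivAt hx) hd
  have hev : ∀ᶠ t in 𝓝 (0 : ℝ), c.ψ (γ t) ∈ c.E := by
    have : ∀ᶠ t in 𝓝 (0 : ℝ), γ t ∈ c.ψ.source :=
      hd.continuousAt.eventually_mem (h0.symm ▸ c.ψ.open_source.mem_nhds hx)
    filter_upwards [hM, this] with t ht ht' using (c.mem_iff _ ht').1 ht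
  have hslope := hasDerivAt_iff_tendsto_slope.1 h1
  refine c.isClosed_E.mem_of_tendsto hslope ?_
  filter_upwards [hev.filter_mono nhdsWithin_le_nhds] with t ht
  exact c.E.smul_mem _ (c.E.sub_mem ht hev.self_of_nhds)

lemma exists_curve {x : X} (hx : x ∈ c.ψ.source) (hxM : x ∈ M) {v : X}
    (hv : fderiv ℝ c.ψ x v ∈ c.E) :
    ∃ γ : ℝ → X, (∀ᶠ t in 𝓝 0, γ t ∈ M) ∧ γ 0 = x ∧ HasDerivAt γ v 0 := by
  set y : ℝ → X := fun t => c.ψ x + t • fderiv ℝ c.ψ x v with hy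
  have hyd : HasDerivAt y (fderiv ℝ c.ψ x v) 0 := hasDerivAt_add_smul _ _ _
  have hy0 : y 0 = c.ψ x := by simp [hy]
  refine ⟨c.ψ.symm ∘ y, ?_, by simp [hy0, c.ψ.left_inv hx], ?_⟩
  · have : ∀ᶠ t in 𝓝 (0 : ℝ), y t ∈ c.ψ.target :=
      hyd.continuousAt.eventually_mem (hy0.symm ▸ c.ψ.open_target.mem_nhds (c.ψ.map_source hx))
    filter_upwards [this] with t ht
    exact c.mem_of_mem_target ht (c.E.add_mem ((c.mem_iff x hx).1 hxM) (c.E.smul_mem _ hv))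
  · have := HasFDerivAt.comp_hasDerivAt 0
      (hy0.symm ▸ c.hasFDerivAt_symm (c.ψ.map_source hx) :
        HasFDerivAt c.ψ.symm (fderiv ℝ c.ψ.symm (c.ψ x)) (y 0)) hyd
    rwa [c.fderiv_symm_fderiv hx] at this

/-- The velocities of curves already fill the linear preimage of `E`, so the span adds nothing and
every tangent vector is the velocity of a single curve. -/
lemma mem_tangentSpaceAt_iff {x : X} (hx : x ∈ c.ψ.source) (hxM : x ∈ M) (v : X) :
    v ∈ tangentSpaceAt M x ↔ fderiv ℝ c.ψ x v ∈ c.E := by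
  constructor
  · intro h
    have : tangentSpaceAt M x ≤ c.E.comap (fderiv ℝ c.ψ x).toLinearMap :=
      Submodule.span_le.2 fun v ⟨γ, h1, h2, h3⟩ => c.fderiv_mem_of_curve hx h1 h2 h3
    exact this h
  · exact fun h => Submodule.subset_span (c.exists_curve hx hxM h)

end C11Chart

namespace IsC11Submanifold
variable {M : Set X} (hM : IsC11Submanifold M)
include hM

lemma exists_curve_of_mem_tangentSpaceAt {u : X} (hu : u ∈ M) {v : X}
    (hv : v ∈ tangentSpaceAt M u) :
    ∃ γ : ℝ → X, (∀ᶠ t in 𝓝 0, γ t ∈ M) ∧ γ 0 = u ∧ HasDerivAt γ v 0 := by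
  obtain ⟨c, hc⟩ := hM.exists_chart hu
  exact c.exists_curve hc hu ((c.mem_tangentSpaceAt_iff hc hu v).1 hv)

lemma isClosed_tangentSpaceAt {u : X} (hu : u ∈ M) :
    IsClosed (tangentSpaceAt M u : Set X) := by
  obtain ⟨c, hc⟩ := hM.exists_chart hu
  have : (tangentSpaceAt M u : Set X) = fderiv ℝ c.ψ u ⁻¹' c.E := by
    ext v; exact c.mem_tangentSpaceAt_iff hc hu v
  rw [this]
  exact c.isClosed_E.preimage (fderiv ℝ c.ψ u).continuous

/-- Tangent vectors at nearby points of `M` are close to each other. -/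
lemma exists_transport {u : X} (hu : u ∈ M) : ∃ U ∈ 𝓝 u, ∃ C : ℝ, 0 < C ∧
    ∀ x ∈ U ∩ M, ∀ y ∈ U ∩ M, ∀ v ∈ tangentSpaceAt M x, ∃ v' ∈ tangentSpaceAt M y,
      ‖v' - v‖ ≤ C * ‖x - y‖ * ‖v‖ := by
  obtain ⟨c, hc⟩ := hM.exists_chart hu
  obtain ⟨r, hr, K, hK, hrs, -, hb, -, hl⟩ := c.c11.exists_bounds c.ψ.open_source hc
  obtain ⟨r', hr', K', hK', -, -, -, hl', -⟩ :=
    c.c11_symm.exists_bounds c.ψ.open_target (c.ψ.map_source hc)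
  have hcont : ContinuousAt c.ψ u := c.ψ.continuousAt hc
  refine ⟨Metric.ball u r ∩ c.ψ ⁻¹' Metric.ball (c.ψ u) r',
    inter_mem (Metric.ball_mem_nhds u hr) (hcont (Metric.ball_mem_nhds _ hr')),
    K' * K * K, by positivity, ?_⟩
  rintro x ⟨⟨hxr, hxr'⟩, hxM⟩ y ⟨⟨hyr, hyr'⟩, hyM⟩ v hv
  have hv' := (c.mem_tangentSpaceAt_iff (hrs hxr) hxM v).1 hv
  -- The transported vector has at `y` the same chart coordinates as `v` has at `x`.
  refine ⟨fderiv ℝ c.ψ.symm (c.ψ y) (fderiv ℝ c.ψ x v), ?_, ?_⟩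
  · rw [c.mem_tangentSpaceAt_iff (hrs hyr) hyM, c.fderiv_fderiv_symm (hrs hyr)]
    exact hv'
  · nth_rw 2 [← c.fderiv_symm_fderiv (hrs hxr) v]
    rw [← sub_apply]
    calc _ ≤ ‖fderiv ℝ c.ψ.symm (c.ψ y) - fderiv ℝ c.ψ.symm (c.ψ x)‖ * (‖fderiv ℝ c.ψ x‖ * ‖v‖) :=
          (ContinuousLinearMap.le_opNorm _ _).trans
            (mul_le_mul_of_nonneg_left (ContinuousLinearMap.le_opNorm _ _) (norm_nonneg _))
      _ ≤ (K' * (K * ‖y - x‖)) * (K * ‖v‖) := by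
          gcongr
          · exact (hl' _ hyr' _ hxr').trans (by gcongr; exact hl _ hyr _ hxr)
          · exact hb _ hxr
      _ = _ := by rw [norm_sub_rev y x]; ring

/-- The length metric is locally bounded by the metric of `X`. -/
lemma exists_lengthDist_le {B : X → LinearMap.BilinForm ℝ X}
    (hB : LocallyUniformlyEquivalent B) {u : X} (hu : u ∈ M) (hu0 : u ≠ 0) :
    ∃ U ∈ 𝓝 u, ∃ C : ℝ, 0 < C ∧ ∀ x ∈ U ∩ M, ∀ y ∈ U ∩ M,
      lengthDist B M x y ≤ ENNReal.ofReal (C * ‖x - y‖) := by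
  obtain ⟨c, hc⟩ := hM.exists_chart hu
  obtain ⟨W, hW, -, C₀, hC₀, hWC⟩ := hB u hu0
  obtain ⟨r, hr, K, hK, hrs, -, -, -, hl⟩ := c.c11.exists_bounds c.ψ.open_source hc
  obtain ⟨r₁, hr₁, K', hK', hrs', hd', hb', hl', -⟩ :=
    c.c11_symm.exists_bounds c.ψ.open_target (c.ψ.map_source hc)
  have hcs : ContinuousAt c.ψ.symm (c.ψ u) := c.ψ.symm.continuousAt (c.ψ.map_source hc)
  obtain ⟨r₂, hr₂, hr₂W⟩ := Metric.mem_nhds_iff.1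
    (hcs.preimage_mem_nhds (by rwa [c.ψ.left_inv hc] : W ∈ 𝓝 (c.ψ.symm (c.ψ u))))
  set r' := min r₁ r₂ with hr'
  have hr'p : 0 < r' := lt_min hr₁ hr₂
  have hb₁ : Metric.ball (c.ψ u) r' ⊆ Metric.ball (c.ψ u) r₁ :=
    Metric.ball_subset_ball (min_le_left _ _)
  have hb₂ : Metric.ball (c.ψ u) r' ⊆ Metric.ball (c.ψ u) r₂ :=
    Metric.ball_subset_ball (min_le_right _ _)
  refine ⟨Metric.ball u r ∩ c.ψ ⁻¹' Metric.ball (c.ψ u) r', inter_mem (Metric.ball_mem_nhds u hr)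
    ((c.ψ.continuousAt hc) (Metric.ball_mem_nhds _ hr'p)), C₀ * (K' * K), by positivity, ?_⟩
  rintro x ⟨⟨hxr, hxr'⟩, hxM⟩ y ⟨⟨hyr, hyr'⟩, hyM⟩
  set e := c.ψ y - c.ψ x with he
  -- The connecting curve is a straight segment in the chart; it stays in the ball by convexity and
  -- in `E` by linearity.
  set z : ℝ → X := fun t => c.ψ x + t • e with hz
  have hzd : ∀ t, HasDerivAt z e t := fun t => hasDerivAt_add_smul _ _ _
  have hzc : Continuous z := by fun_prop
  have hu01 : uIcc (0 : ℝ) 1 = Icc 0 1 := uIcc_of_le zero_le_one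
  have hzb : ∀ t ∈ Icc (0 : ℝ) 1, z t ∈ Metric.ball (c.ψ u) r' := fun t ht => by
    have := (convex_ball (c.ψ u) r').add_smul_sub_mem hxr' hyr' ht
    exact this
  have hxE := (c.mem_iff x (hrs hxr)).1 hxM
  have hyE := (c.mem_iff y (hrs hyr)).1 hyM
  have key := lengthDist_le_of_speed_le B (M := M) (γ := c.ψ.symm ∘ z)
    (γ' := fun t => fderiv ℝ c.ψ.symm (z t) e) (a := 0) (b := 1) (L := C₀ * (K' * (K * ‖x - y‖)))
    (fun t ht => (hd' _ (hb₁ (hzb t (hu01 ▸ ht)))).comp_hasDerivAt t (hzd t)) ?_ ?_ ?_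
  · have h0 : (c.ψ.symm ∘ z) 0 = x := by simp [hz, c.ψ.left_inv (hrs hxr)]
    have h1 : (c.ψ.symm ∘ z) 1 = y := by simp [hz, he, c.ψ.left_inv (hrs hyr)]
    rw [h0, h1] at key
    refine key.trans (le_of_eq ?_)
    norm_num
    ring_nf
  · have : ContinuousOn (fun t => fderiv ℝ c.ψ.symm (z t)) (uIcc 0 1) :=
      c.c11_symm.2.continuousOn.comp hzc.continuousOn
        fun t ht => hrs' (hb₁ (hzb t (hu01 ▸ ht)))
    exact this.clm_apply continuousOn_const
  · intro t ht
    refine c.mem_of_mem_target (hrs' (hb₁ (hzb t (hu01 ▸ ht)))) ?_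
    exact c.E.add_mem hxE (c.E.smul_mem _ (c.E.sub_mem hyE hxE))
  · intro t ht
    rw [hu01] at ht
    refine ((hWC _ (hr₂W (hb₂ (hzb t ht))) _).2).trans ?_
    gcongr
    refine (ContinuousLinearMap.le_opNorm _ _).trans ?_
    gcongr
    · exact hb' _ (hb₁ (hzb t ht))
    · rw [norm_sub_rev]; exact hl x hxr y hyr

end IsC11Submanifold

end NCerami

namespace NCerami
variable {X : Type*} [NormedAddCommGroup X] [InnerProductSpace ℝ X]

/-! ### Calculus of locally Lipschitz maps -/

section LocallyLipschitz
variable {F : Type*} [NormedAddCommGroup F] {M : Set X}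

lemma LocallyLipschitzOn.exists_bound {f : X → F} (hf : LocallyLipschitzOn M f) {u : X}
    (hu : u ∈ M) : ∃ U ∈ 𝓝 u, ∃ K : ℝ, 0 < K ∧
      (∀ v ∈ U ∩ M, ‖f v‖ ≤ K) ∧ ∀ v ∈ U ∩ M, ∀ w ∈ U ∩ M, ‖f v - f w‖ ≤ K * ‖v - w‖ := by
  obtain ⟨U, hU, K, hK, hUK⟩ := locallyLipschitzOn_iff.1 hf u hu
  refine ⟨U ∩ Metric.ball u 1, inter_mem hU (Metric.ball_mem_nhds u one_pos), K + ‖f u‖,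
    by positivity, fun v hv => ?_, fun v hv w hw => ?_⟩
  · have h1 := hUK v ⟨hv.1.1, hv.2⟩ u ⟨mem_of_mem_nhds hU, hu⟩
    have h2 : ‖v - u‖ < 1 := mem_ball_iff_norm.1 hv.1.2
    have h3 := norm_le_norm_sub_add (f v) (f u)
    nlinarith
  · refine (hUK v ⟨hv.1.1, hv.2⟩ w ⟨hw.1.1, hw.2⟩).trans ?_
    gcongr
    linarith [norm_nonneg (f u)]

lemma LocallyLipschitzOn.comp_of_lipschitz {f : X → ℝ} {g : ℝ → ℝ} {L : ℝ}
    (hf : LocallyLipschitzOn M f) (hg : ∀ a b, |g a - g b| ≤ L * |a - b|) :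
    LocallyLipschitzOn M fun u => g (f u) := by
  rw [locallyLipschitzOn_iff] at hf ⊢
  intro u hu
  obtain ⟨U, hU, K, hK, hUK⟩ := hf u hu
  refine ⟨U, hU, (|L| + 1) * K, by positivity, fun v hv w hw => ?_⟩
  calc _ ≤ L * |f v - f w| := hg _ _
    _ ≤ (|L| + 1) * |f v - f w| := by gcongr; linarith [le_abs_self L]
    _ ≤ (|L| + 1) * (K * ‖v - w‖) := by gcongr; exact hUK v hv w hw
    _ = _ := by ring

lemma LocallyLipschitzOn.smul_fun [NormedSpace ℝ F] {f : X → ℝ} {g : X → F}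
    (hf : LocallyLipschitzOn M f) (hg : LocallyLipschitzOn M g) :
    LocallyLipschitzOn M fun u => f u • g u := by
  rw [locallyLipschitzOn_iff]
  intro u hu
  obtain ⟨U, hU, K, hK, hb, hUK⟩ := LocallyLipschitzOn.exists_bound hf hu
  obtain ⟨U', hU', K', hK', hb', hUK'⟩ := LocallyLipschitzOn.exists_bound hg hu
  refine ⟨U ∩ U', inter_mem hU hU', K * K' + K * K', by positivity, ?_⟩
  rintro v ⟨⟨hv, hv'⟩, hvM⟩ w ⟨⟨hw, hw'⟩, hwM⟩
  calc ‖f v • g v - f w • g w‖ = ‖f v • (g v - g w) + (f v - f w) • g w‖ := by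
        rw [smul_sub, sub_smul]; abel_nf
    _ ≤ ‖f v‖ * ‖g v - g w‖ + ‖f v - f w‖ * ‖g w‖ :=
        (norm_add_le _ _).trans (by rw [norm_smul, norm_smul])
    _ ≤ K * (K' * ‖v - w‖) + (K * ‖v - w‖) * K' := by
        gcongr
        · exact hb v ⟨hv, hvM⟩
        · exact hUK' v ⟨hv', hvM⟩ w ⟨hw', hwM⟩
        · exact hUK v ⟨hv, hvM⟩ w ⟨hw, hwM⟩
        · exact hb' w ⟨hw', hwM⟩
    _ = _ := by ring

lemma LocallyLipschitzOn.mul_fun {f g : X → ℝ} (hf : LocallyLipschitzOn M f)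
    (hg : LocallyLipschitzOn M g) : LocallyLipschitzOn M fun u => f u * g u :=
  LocallyLipschitzOn.smul_fun hf hg

lemma LocallyLipschitzOn.max_fun {f g : X → ℝ} (hf : LocallyLipschitzOn M f)
    (hg : LocallyLipschitzOn M g) : LocallyLipschitzOn M fun u => max (f u) (g u) := by
  rw [locallyLipschitzOn_iff] at hf hg ⊢
  intro u hu
  obtain ⟨U, hU, K, hK, hUK⟩ := hf u hu
  obtain ⟨U', hU', K', hK', hUK'⟩ := hg u hu
  refine ⟨U ∩ U', inter_mem hU hU', max K K', lt_max_of_lt_left hK, ?_⟩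
  rintro v ⟨⟨hv, hv'⟩, hvM⟩ w ⟨⟨hw, hw'⟩, hwM⟩
  refine (abs_max_sub_max_le_max _ _ _ _).trans (max_le ?_ ?_)
  · exact (hUK v ⟨hv, hvM⟩ w ⟨hw, hwM⟩).trans (by gcongr; exact le_max_left _ _)
  · exact (hUK' v ⟨hv', hvM⟩ w ⟨hw', hwM⟩).trans (by gcongr; exact le_max_right _ _)

lemma LocallyLipschitzOn.inv_fun {f : X → ℝ} (hf : LocallyLipschitzOn M f)
    (hpos : ∀ u ∈ M, 0 < f u) : LocallyLipschitzOn M fun u => (f u)⁻¹ := by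
  rw [locallyLipschitzOn_iff]
  intro u hu
  obtain ⟨U, hU, K, hK, hUK⟩ := locallyLipschitzOn_iff.1 hf u hu
  have hp := hpos u hu
  obtain ⟨W, hW, hWf⟩ := mem_nhdsWithin_iff_exists_mem_nhds_inter.1
    ((hf.continuousOn u hu).eventually (lt_mem_nhds (half_lt_self hp)))
  refine ⟨U ∩ W, inter_mem hU hW, K / (f u / 2 * (f u / 2)), by positivity, ?_⟩
  rintro v ⟨⟨hv, hv'⟩, hvM⟩ w ⟨⟨hw, hw'⟩, hwM⟩
  have h1 : f u / 2 < f v := hWf ⟨hv', hvM⟩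
  have h2 : f u / 2 < f w := hWf ⟨hw', hwM⟩
  have hv0 := hpos v hvM
  have hw0 := hpos w hwM
  have h3 : (f v)⁻¹ - (f w)⁻¹ = (f w - f v) / (f v * f w) := by field_simp
  rw [h3, norm_div, norm_mul, div_mul_eq_mul_div, norm_sub_rev, Real.norm_of_nonneg hv0.le,
    Real.norm_of_nonneg hw0.le]
  gcongr
  exact hUK v ⟨hv, hvM⟩ w ⟨hw, hwM⟩

end LocallyLipschitz

/-! ### Derivatives of `C^{1,1}`-functions on `M` -/

section Derivative
variable {M : Set X} {Φ : X → ℝ}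

lemma IsC11FunctionOn.hasFDerivWithinAt (hΦ : IsC11FunctionOn M Φ) {u : X} (hu : u ∈ M) :
    HasFDerivWithinAt Φ (fderivWithin ℝ Φ M u) M u := by
  obtain ⟨O, Ψ, hO, huO, hΨ, heq⟩ := hΦ u hu
  have h1 : HasFDerivWithinAt Ψ (fderiv ℝ Ψ u) M u :=
    ((hΨ.1.differentiableOn one_ne_zero u huO).differentiableAt
      (hO.mem_nhds huO)).hasFDerivAt.hasFDerivWithinAt
  have h2 : Φ =ᶠ[𝓝[M] u] Ψ := by
    filter_upwards [mem_nhdsWithin_of_mem_nhds (hO.mem_nhds huO), self_mem_nhdsWithin]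
      with x hx hxM using heq ⟨hx, hxM⟩
  exact (h1.congr_of_eventuallyEq h2 (heq ⟨huO, hu⟩)).differentiableWithinAt.hasFDerivWithinAt

lemma IsC11FunctionOn.continuousOn (hΦ : IsC11FunctionOn M Φ) : ContinuousOn Φ M :=
  fun _ hu => (hΦ.hasFDerivWithinAt hu).continuousWithinAt

lemma IsC11FunctionOn.hasDerivAt_comp (hΦ : IsC11FunctionOn M Φ) {γ : ℝ → X} {v : X} {t : ℝ}
    (hM : ∀ᶠ s in 𝓝 t, γ s ∈ M) (hd : HasDerivAt γ v t) :
    HasDerivAt (fun s => Φ (γ s)) (derivOn M Φ (γ t) v) t :=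
  (hΦ.hasFDerivWithinAt hM.self_of_nhds).comp_hasDerivAt t hd hM

lemma IsC11FunctionOn.locallyLipschitzOn (hΦ : IsC11FunctionOn M Φ) :
    LocallyLipschitzOn M Φ := by
  rw [locallyLipschitzOn_iff]
  intro u hu
  obtain ⟨O, Ψ, hO, huO, hΨ, heq⟩ := hΦ u hu
  obtain ⟨r, hr, K, hK, hrO, -, -, -, hl⟩ := hΨ.exists_bounds hO huO
  refine ⟨Metric.ball u r, Metric.ball_mem_nhds u hr, K, hK, fun v hv w hw => ?_⟩
  rw [heq ⟨hrO hv.1, hv.2⟩, heq ⟨hrO hw.1, hw.2⟩]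
  exact hl v hv.1 w hw.1

/-- On tangent vectors `Φ'` agrees with the full derivative of a local extension, since both
differentiate `Φ` along the same curve. The extension accepts all vectors of `X`, so derivatives at
different base points can be compared. -/
lemma IsC11FunctionOn.exists_extension (hM : IsC11Submanifold M) (hΦ : IsC11FunctionOn M Φ)
    {u : X} (hu : u ∈ M) : ∃ U ∈ 𝓝 u, ∃ (D : X → X →L[ℝ] ℝ) (K : ℝ), 0 < K ∧
      (∀ x ∈ U ∩ M, ∀ v ∈ tangentSpaceAt M x, derivOn M Φ x v = D x v) ∧
      (∀ x ∈ U, ‖D x‖ ≤ K) ∧ ∀ x ∈ U, ∀ y ∈ U, ‖D x - D y‖ ≤ K * ‖x - y‖ := by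
  obtain ⟨O, Ψ, hO, huO, hΨ, heq⟩ := hΦ u hu
  obtain ⟨r, hr, K, hK, hrO, hd, hb, hl, -⟩ := hΨ.exists_bounds hO huO
  refine ⟨Metric.ball u r, Metric.ball_mem_nhds u hr, fderiv ℝ Ψ, K, hK, fun x hx v hv => ?_,
    hb, hl⟩
  obtain ⟨γ, hγM, rfl, hγ⟩ := hM.exists_curve_of_mem_tangentSpaceAt hx.2 hv
  have h1 := hΦ.hasDerivAt_comp hγM hγ
  have h2 := (hd _ hx.1).comp_hasDerivAt 0 hγ
  refine h1.unique (h2.congr_of_eventuallyEq ?_)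
  filter_upwards [hγM, hγ.continuousAt.eventually_mem (hO.mem_nhds (hrO hx.1))] with t ht ht'
    using heq ⟨ht', ht⟩

end Derivative

/-! ### The gradient -/

/-- The standing assumptions on the scalar products, the submanifold and the functional. -/
structure IsGradientSetting (B : X → LinearMap.BilinForm ℝ X) (M : Set X) (Φ : X → ℝ) : Prop where
  isScalarProductFamily : IsScalarProductFamily B
  equivalent : LocallyUniformlyEquivalent B
  lipschitz : LocallyLipschitzFamily B
  submanifold : IsC11Submanifold M
  zero_notMem : (0 : X) ∉ M
  c11 : IsC11FunctionOn M Φ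

open Classical in
/-- The gradient field of `Φ` on `M`. -/
def gradOn (B : X → LinearMap.BilinForm ℝ X) (M : Set X) (Φ : X → ℝ) (u : X) : X :=
  if h : ∃ w, IsGradientAt B M Φ u w then h.choose else 0

namespace IsGradientSetting
variable {B : X → LinearMap.BilinForm ℝ X} {M : Set X} {Φ : X → ℝ}
  (h : IsGradientSetting B M Φ)
include h

lemma ne_zero {u : X} (hu : u ∈ M) : u ≠ 0 := fun h0 => h.zero_notMem (h0 ▸ hu)

lemma isGradientAt_unique {u : X} (hu : u ∈ M) {w w' : X} (hw : IsGradientAt B M Φ u w)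
    (hw' : IsGradientAt B M Φ u w') : w = w' := by
  by_contra hne
  have hT := (tangentSpaceAt M u).sub_mem hw.1 hw'.1
  have h1 := (h.isScalarProductFamily u (h.ne_zero hu)).2 (w - w') (sub_ne_zero.2 hne)
  have h2 := hw.2 _ hT
  rw [hw'.2 _ hT] at h2
  rw [LinearMap.BilinForm.sub_left, h2, sub_self] at h1
  exact lt_irrefl _ h1

/-- By (M1) the form `B u` is bounded and coercive on the closed, hence complete, tangent space;
Lax–Milgram represents `Φ'(u)`. -/
lemma exists_isGradientAt [CompleteSpace X] {u : X} (hu : u ∈ M) :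
    ∃ w, IsGradientAt B M Φ u w := by
  obtain ⟨U, hU, -, C, hC, hUC⟩ := h.equivalent u (h.ne_zero hu)
  have hC' := hUC u (mem_of_mem_nhds hU)
  set T := tangentSpaceAt M u with hT
  have : CompleteSpace T := (h.submanifold.isClosed_tangentSpaceAt hu).completeSpace_coe
  set b : T →L[ℝ] T →L[ℝ] ℝ := LinearMap.mkContinuous₂ ((B u).domRestrict₁₂ T T) (C * C) (by
    intro v w
    refine (h.isScalarProductFamily.abs_apply_le (h.ne_zero hu) v w).trans ?_
    calc _ ≤ (C * ‖(v : X)‖) * (C * ‖(w : X)‖) :=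
          mul_le_mul (hC' _).2 (hC' _).2 (normAt_nonneg _ _ _) (by positivity)
      _ = _ := by rw [Submodule.coe_norm, Submodule.coe_norm]; ring) with hb
  have hco : IsCoercive b := by
    refine ⟨1 / C * (1 / C), by positivity, fun v => ?_⟩
    change _ ≤ B u v v
    rw [← h.isScalarProductFamily.normAt_sq (h.ne_zero hu)]
    have := (hC' v).1
    calc _ = (1 / C * ‖(v : X)‖) * (1 / C * ‖(v : X)‖) := by rw [Submodule.coe_norm]; ring
      _ ≤ normAt B u v * normAt B u v := mul_self_le_mul_self (by positivity) this
      _ = _ := (sq _).symm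
  set ℓ : T →L[ℝ] ℝ := (fderivWithin ℝ Φ M u).comp T.subtypeL
  set w : T := hco.continuousLinearEquivOfBilin.symm ((InnerProductSpace.toDual ℝ T).symm ℓ)
  refine ⟨w, w.2, fun v hv => ?_⟩
  have h1 : b w ⟨v, hv⟩ = ℓ ⟨v, hv⟩ := by
    rw [← hco.continuousLinearEquivOfBilin_apply, ContinuousLinearEquiv.apply_symm_apply,
      InnerProductSpace.toDual_symm_apply]
  exact h1.symm

lemma isGradientAt_gradOn [CompleteSpace X] {u : X} (hu : u ∈ M) :
    IsGradientAt B M Φ u (gradOn B M Φ u) := by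
  have hex := h.exists_isGradientAt hu
  rw [gradOn, dif_pos hex]
  exact hex.choose_spec

lemma gradOn_eq [CompleteSpace X] {u : X} (hu : u ∈ M) {w : X} (hw : IsGradientAt B M Φ u w) :
    gradOn B M Φ u = w :=
  h.isGradientAt_unique hu (h.isGradientAt_gradOn hu) hw

/-- The gradients at `x` and `y` lie in different tangent spaces. The one at `y` is transported to
`T_x M`, and coercivity of `B x` is applied to the difference `v`; each term in the expansion of `B
x v v` is of order `‖x - y‖ ‖v‖`. -/
lemma locallyLipschitzOn_gradOn [CompleteSpace X] :
    LocallyLipschitzOn M (gradOn B M Φ) := by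
  rw [locallyLipschitzOn_iff]
  intro u hu
  obtain ⟨U₁, hU₁, -, C₁, hC₁, he⟩ := h.equivalent u (h.ne_zero hu)
  obtain ⟨U₂, hU₂, -, C₂, hC₂, hL⟩ := h.lipschitz u (h.ne_zero hu)
  obtain ⟨U₃, hU₃, C₃, hC₃, htr⟩ := h.submanifold.exists_transport hu
  obtain ⟨U₄, hU₄, D, K, hK, hD, hDb, hDl⟩ := h.c11.exists_extension h.submanifold hu
  -- `R` bounds the gradient near `u`; `S` adds up the constants of the five estimates `b1` to `b5`.
  set R := C₁ ^ 2 * K with hR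
  set S := K + K * C₃ + 2 * (C₁ ^ 2 * R * C₃) + C₂ * R with hS
  have hRp : 0 < R := by positivity
  have hSp : 0 < S := by positivity
  refine ⟨U₁ ∩ U₂ ∩ (U₃ ∩ U₄), inter_mem (inter_mem hU₁ hU₂) (inter_mem hU₃ hU₄),
    C₁ ^ 2 * S + C₃ * R, by positivity, ?_⟩
  have hBb : ∀ x ∈ U₁, x ∈ M → ∀ v w, |B x v w| ≤ C₁ ^ 2 * ‖v‖ * ‖w‖ := fun x hx hxM v w => by
    refine (h.isScalarProductFamily.abs_apply_le (h.ne_zero hxM) v w).trans ?_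
    calc _ ≤ (C₁ * ‖v‖) * (C₁ * ‖w‖) :=
          mul_le_mul (he x hx v).2 (he x hx w).2 (normAt_nonneg _ _ _) (by positivity)
      _ = _ := by ring
  have hBc : ∀ x ∈ U₁, x ∈ M → ∀ v a, 0 ≤ a → B x v v ≤ a * ‖v‖ → ‖v‖ ≤ C₁ ^ 2 * a :=
      fun x hx hxM v a ha hva => by
    rcases eq_or_ne v 0 with rfl | hv
    · rw [norm_zero]
      positivity
    · rw [← h.isScalarProductFamily.normAt_sq (h.ne_zero hxM)] at hva
      have h1 := (he x hx v).1
      rw [one_div, inv_mul_le_iff₀ hC₁] at h1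
      have h2 : ‖v‖ * ‖v‖ ≤ (C₁ ^ 2 * a) * ‖v‖ := by
        calc ‖v‖ * ‖v‖ ≤ (C₁ * normAt B x v) * (C₁ * normAt B x v) :=
              mul_self_le_mul_self (norm_nonneg _) h1
          _ = C₁ ^ 2 * normAt B x v ^ 2 := by ring
          _ ≤ C₁ ^ 2 * (a * ‖v‖) := by gcongr
          _ = _ := by ring
      exact le_of_mul_le_mul_right h2 (norm_pos_iff.2 hv)
  have hgb : ∀ x ∈ U₁, x ∈ U₄ → x ∈ M → ‖gradOn B M Φ x‖ ≤ R := fun x hx hx' hxM => by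
    obtain ⟨hgT, hg⟩ := h.isGradientAt_gradOn hxM
    refine hBc x hx hxM _ K hK.le ?_
    rw [← hg _ hgT, hD x ⟨hx', hxM⟩ _ hgT]
    exact (le_abs_self _).trans (((D x).le_opNorm _).trans (by gcongr; exact hDb x hx'))
  rintro x ⟨⟨⟨hx₁, hx₂⟩, hx₃, hx₄⟩, hxM⟩ y ⟨⟨⟨hy₁, hy₂⟩, hy₃, hy₄⟩, hyM⟩
  obtain ⟨hT₁, hg₁⟩ := h.isGradientAt_gradOn hxM
  obtain ⟨hT₂, hg₂⟩ := h.isGradientAt_gradOn hyM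
  have hR₂ := hgb y hy₁ hy₄ hyM
  set w₁ := gradOn B M Φ x
  set w₂ := gradOn B M Φ y
  obtain ⟨w₂', hw₂', hd₂⟩ := htr y ⟨hy₃, hyM⟩ x ⟨hx₃, hxM⟩ w₂ hT₂
  have hvT := (tangentSpaceAt M x).sub_mem hT₁ hw₂'
  set v := w₁ - w₂' with hv
  obtain ⟨v', hv', hdv⟩ := htr x ⟨hx₃, hxM⟩ y ⟨hy₃, hyM⟩ v hvT
  set d := ‖x - y‖ with hd
  have hd0 : 0 ≤ d := norm_nonneg _
  rw [norm_sub_rev y x] at hd₂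
  have hd₂' : ‖w₂ - w₂'‖ ≤ C₃ * d * R := by
    rw [norm_sub_rev]; exact hd₂.trans (by gcongr)
  -- The gradient identity at `y` applies only to vectors of `T_y M`, so `v` is first replaced by
  -- its transport `v'`; the correction terms measure the changes of derivative, vector and form.
  have e0 : B x v v = (D x - D y) v + D y (v - v') +
      (B y w₂ (v' - v) + (B y w₂ v - B x w₂ v) + B x (w₂ - w₂') v) := by
    have e1 : B x w₁ v = D x v := by rw [← hg₁ v hvT, hD x ⟨hx₄, hxM⟩ v hvT]
    have e2 : B y w₂ v' = D y v' := by rw [← hg₂ v' hv', hD y ⟨hy₄, hyM⟩ v' hv']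
    have e3 : B x v v = B x w₁ v - B x w₂' v := by
      rw [← LinearMap.BilinForm.sub_left]
    rw [e3, e1, sub_apply, (D y).map_sub v v', LinearMap.BilinForm.sub_right w₂ v' v,
      LinearMap.BilinForm.sub_left w₂ w₂' v, e2]
    ring
  have b1 : (D x - D y) v ≤ K * d * ‖v‖ :=
    (le_abs_self _).trans (((D x - D y).le_opNorm v).trans (by gcongr; exact hDl x hx₄ y hy₄))
  have b2 : D y (v - v') ≤ K * (C₃ * d * ‖v‖) :=
    (le_abs_self _).trans (((D y).le_opNorm _).trans (by
      gcongr
      · exact hDb y hy₄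
      · rw [norm_sub_rev]; exact hdv))
  have b3 : B y w₂ (v' - v) ≤ C₁ ^ 2 * R * (C₃ * d * ‖v‖) :=
    (le_abs_self _).trans ((hBb y hy₁ hyM _ _).trans (by gcongr))
  have b4 : B y w₂ v - B x w₂ v ≤ C₂ * d * R * ‖v‖ := by
    refine (le_abs_self _).trans ((hL y hy₂ x hx₂ _ _).trans ?_)
    rw [norm_sub_rev y x]
    gcongr
  have b5 : B x (w₂ - w₂') v ≤ C₁ ^ 2 * (C₃ * d * R) * ‖v‖ :=
    (le_abs_self _).trans ((hBb x hx₁ hxM _ _).trans (by gcongr))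
  have hvb : ‖v‖ ≤ C₁ ^ 2 * (S * d) := by
    refine hBc x hx₁ hxM v _ (by positivity) ?_
    rw [e0, hS]
    linarith
  calc ‖w₁ - w₂‖ = ‖v - (w₂ - w₂')‖ := by rw [hv]; congr 1; abel
    _ ≤ ‖v‖ + ‖w₂ - w₂'‖ := norm_sub_le _ _
    _ ≤ C₁ ^ 2 * (S * d) + C₃ * d * R := add_le_add hvb hd₂'
    _ = _ := by ring

lemma locallyLipschitzOn_apply_self {w : X → X} (hw : LocallyLipschitzOn M w) :
    LocallyLipschitzOn M fun u => B u (w u) (w u) := by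
  rw [locallyLipschitzOn_iff]
  intro u hu
  obtain ⟨U₁, hU₁, -, C₁, hC₁, he⟩ := h.equivalent u (h.ne_zero hu)
  obtain ⟨U₂, hU₂, -, C₂, hC₂, hL⟩ := h.lipschitz u (h.ne_zero hu)
  obtain ⟨U₃, hU₃, K, hK, hb, hl⟩ := LocallyLipschitzOn.exists_bound hw hu
  refine ⟨U₁ ∩ U₂ ∩ U₃, inter_mem (inter_mem hU₁ hU₂) hU₃,
    C₂ * K * K + C₁ ^ 2 * K * K + C₁ ^ 2 * K * K, by positivity, ?_⟩
  rintro x ⟨⟨⟨hx₁, hx₂⟩, hx₃⟩, hxM⟩ y ⟨⟨⟨hy₁, hy₂⟩, hy₃⟩, hyM⟩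
  have hBb : ∀ v w, |B y v w| ≤ C₁ ^ 2 * ‖v‖ * ‖w‖ := fun v w => by
    refine (h.isScalarProductFamily.abs_apply_le (h.ne_zero hyM) v w).trans ?_
    calc _ ≤ (C₁ * ‖v‖) * (C₁ * ‖w‖) :=
          mul_le_mul (he y hy₁ v).2 (he y hy₁ w).2 (normAt_nonneg _ _ _) (by positivity)
      _ = _ := by ring
  have e : B x (w x) (w x) - B y (w y) (w y) = (B x (w x) (w x) - B y (w x) (w x)) +
      B y (w x - w y) (w x) + B y (w y) (w x - w y) := by
    rw [LinearMap.BilinForm.sub_left, LinearMap.BilinForm.sub_right]; ring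
  have hbx := hb x ⟨hx₃, hxM⟩
  have hby := hb y ⟨hy₃, hyM⟩
  have hxy := hl x ⟨hx₃, hxM⟩ y ⟨hy₃, hyM⟩
  rw [e]
  calc _ ≤ |B x (w x) (w x) - B y (w x) (w x)| + |B y (w x - w y) (w x)| +
        |B y (w y) (w x - w y)| := abs_add_three _ _ _
    _ ≤ C₂ * ‖x - y‖ * K * K + C₁ ^ 2 * (K * ‖x - y‖) * K + C₁ ^ 2 * K * (K * ‖x - y‖) := by
        gcongr
        · exact (hL x hx₂ y hy₂ _ _).trans (by gcongr)
        · exact (hBb _ _).trans (by gcongr)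
        · exact (hBb _ _).trans (by gcongr)
    _ = _ := by ring

end IsGradientSetting

end NCerami

namespace NCerami
variable {X : Type*} [NormedAddCommGroup X] [InnerProductSpace ℝ X]

/-! ### Flow lines of a locally Lipschitz tangent field -/

/-- `γ` is a flow line in `M` of the vector field `V` over the open set `J` of times. -/
def IsFlowLine (V : X → X) (M : Set X) (γ : ℝ → X) (J : Set ℝ) : Prop :=
  ∀ t ∈ J, γ t ∈ M ∧ HasDerivAt γ (V (γ t)) t

namespace IsFlowLine
variable {V : X → X} {M : Set X} {γ γ₁ γ₂ : ℝ → X} {J : Set ℝ}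

lemma mono (h : IsFlowLine V M γ J) {J' : Set ℝ} (hJ : J' ⊆ J) : IsFlowLine V M γ J' :=
  fun t ht => h t (hJ ht)

lemma congr (h : IsFlowLine V M γ₁ J) (hJ : IsOpen J) (he : EqOn γ₂ γ₁ J) :
    IsFlowLine V M γ₂ J := fun t ht => by
  rw [he ht]
  exact ⟨(h t ht).1, (h t ht).2.congr_of_eventuallyEq
    (by filter_upwards [hJ.mem_nhds ht] with s hs using he hs)⟩

lemma union (h : IsFlowLine V M γ J) {J' : Set ℝ} (h' : IsFlowLine V M γ J') :
    IsFlowLine V M γ (J ∪ J') := fun t ht => ht.elim (h t) (h' t)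

lemma continuousOn (h : IsFlowLine V M γ J) : ContinuousOn γ J :=
  fun t ht => (h t ht).2.continuousAt.continuousWithinAt

lemma comp_sub (h : IsFlowLine V M γ J) (s : ℝ) :
    IsFlowLine V M (fun t => γ (t - s)) {t | t - s ∈ J} := fun t ht =>
  ⟨(h _ ht).1, (h _ ht).2.comp_sub_const t s⟩

lemma comp_neg (h : IsFlowLine V M γ J) :
    IsFlowLine (fun x => -V x) M (fun t => γ (-t)) {t | -t ∈ J} := fun t ht =>
  ⟨(h _ ht).1, by simpa using! (h _ ht).2.scomp t (hasDerivAt_neg t)⟩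

lemma eventuallyEq (hV : LocallyLipschitzOn M V) (h₁ : IsFlowLine V M γ₁ J)
    (h₂ : IsFlowLine V M γ₂ J) (hJ : IsOpen J) {t : ℝ} (ht : t ∈ J) (he : γ₁ t = γ₂ t) :
    γ₁ =ᶠ[𝓝 t] γ₂ := by
  obtain ⟨K, s, hs, hK⟩ := hV (h₁ t ht).1
  have hmem : ∀ γ : ℝ → X, IsFlowLine V M γ J → γ t = γ₁ t →
      ∀ᶠ r in 𝓝 t, HasDerivAt γ (V (γ r)) r ∧ γ r ∈ s := fun γ hγ hγt => by
    have hc : Tendsto γ (𝓝 t) (𝓝[M] (γ₁ t)) := by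
      refine tendsto_nhdsWithin_iff.2 ⟨hγt ▸ (hγ t ht).2.continuousAt, ?_⟩
      filter_upwards [hJ.mem_nhds ht] with r hr using (hγ r hr).1
    filter_upwards [hJ.mem_nhds ht, hc hs] with r hr hr' using ⟨(hγ r hr).2, hr'⟩
  exact ODE_solution_unique_of_eventually (v := fun _ => V) (s := fun _ => s)
    (Eventually.of_forall fun _ => hK) (hmem γ₁ h₁ rfl) (hmem γ₂ h₂ he.symm) he

/-- The times of local agreement form an open set by local uniqueness, the times of disagreement one
by continuity, and `J` is connected. -/
lemma eqOn (hV : LocallyLipschitzOn M V) (h₁ : IsFlowLine V M γ₁ J)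
    (h₂ : IsFlowLine V M γ₂ J) (hJ : IsOpen J) (hJc : IsPreconnected J) {t : ℝ} (ht : t ∈ J)
    (he : γ₁ t = γ₂ t) : EqOn γ₁ γ₂ J := by
  have hv : IsOpen (J ∩ {s | γ₁ s - γ₂ s ∈ ({0}ᶜ : Set X)}) :=
    (h₁.continuousOn.sub h₂.continuousOn).isOpen_inter_preimage hJ isOpen_compl_singleton
  have hu : IsOpen {s | γ₁ =ᶠ[𝓝 s] γ₂} := isOpen_setOfPred_eventually_nhds
  have hsub := hJc.subset_left_of_subset_union hu hv ?_ ?_ ⟨t, ht, eventuallyEq hV h₁ h₂ hJ ht he⟩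
  · exact fun s hs => (hsub hs).self_of_nhds
  · refine disjoint_left.2 fun s hs hs' => hs'.2 ?_
    simp [Filter.EventuallyEq.eq_of_nhds hs]
  · intro s hs
    by_cases heq : γ₁ s = γ₂ s
    · exact Or.inl (eventuallyEq hV h₁ h₂ hJ hs heq)
    · exact Or.inr ⟨hs, by simpa [sub_eq_zero] using heq⟩

end IsFlowLine

/-- `V` has local flows in `M` near each point of `M`. -/
def HasLocalFlow (V : X → X) (M : Set X) : Prop :=
  ∀ u ∈ M, ∃ τ > 0, ∃ U ∈ 𝓝 u, ∃ φ : X × ℝ → X,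
    (∀ x ∈ U ∩ M, φ (x, 0) = x ∧ IsFlowLine V M (fun t => φ (x, t)) (Ioo (-τ) τ)) ∧
    ContinuousOn φ ((U ∩ M) ×ˢ Ioo (-τ) τ)

-- In a chart, a tangent field becomes a Lipschitz field on the Banach space `E`, to which
-- Picard–Lindelöf applies; the solutions are carried back by `ψ.symm`.
open Classical in
lemma IsC11Submanifold.hasLocalFlow [CompleteSpace X] {M : Set X} (hM : IsC11Submanifold M)
    {V : X → X} (hV : LocallyLipschitzOn M V) (hT : ∀ u ∈ M, V u ∈ tangentSpaceAt M u) :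
    HasLocalFlow V M := by
  intro u hu
  obtain ⟨c, hc⟩ := hM.exists_chart hu
  have : CompleteSpace c.E := c.isClosed_E.completeSpace_coe
  obtain ⟨r₁, hr₁, K₁, hK₁, hs₁, -, hb₁, hD₁, -⟩ := c.c11.exists_bounds c.ψ.open_source hc
  obtain ⟨r₂, hr₂, K₂, hK₂, hs₂, -, -, -, hl₂⟩ :=
    c.c11_symm.exists_bounds c.ψ.open_target (c.ψ.map_source hc)
  obtain ⟨W, hW, K₃, hK₃, hb₃, hl₃⟩ := LocallyLipschitzOn.exists_bound hV hu
  have hcs : ContinuousAt c.ψ.symm (c.ψ u) := c.ψ.symm.continuousAt (c.ψ.map_source hc)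
  obtain ⟨r₃, hr₃, hs₃⟩ := Metric.mem_nhds_iff.1
    (hcs.preimage_mem_nhds (by rw [c.ψ.left_inv hc]; exact inter_mem (Metric.ball_mem_nhds u hr₁) hW))
  set a : ℝ := min r₂ r₃ / 2 with ha
  have hap : 0 < a := by positivity
  set w : X → X := fun y => fderiv ℝ c.ψ (c.ψ.symm y) (V (c.ψ.symm y)) with hw
  -- The default value `0` is never met on the ball used below: tangency of `V` puts `w y` in `E`
  -- there (`hball`).
  set F : c.E → c.E := fun y => if h : w y ∈ c.E then ⟨w y, h⟩ else 0 with hF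
  set e : X → c.E := fun x => if h : c.ψ x ∈ c.E then ⟨c.ψ x, h⟩ else 0 with he
  set y₀ : c.E := e u with hy₀
  have heM : ∀ x ∈ c.ψ.source, x ∈ M → (e x : X) = c.ψ x := fun x hx hxM => by
    have := (c.mem_iff x hx).1 hxM
    simp [he, this]
  have hball : ∀ y ∈ Metric.closedBall y₀ a, (y : X) ∈ Metric.ball (c.ψ u) r₂ ∧
      c.ψ.symm y ∈ Metric.ball u r₁ ∧ c.ψ.symm y ∈ W ∩ M ∧ (F y : X) = w y := fun y hy => by
    have h1 : (y : X) ∈ Metric.ball (c.ψ u) (min r₂ r₃) := by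
      rw [← heM u hc hu]
      have : dist (y : X) (y₀ : X) ≤ a := hy
      exact this.trans_lt (half_lt_self (lt_min hr₂ hr₃))
    have h2 := Metric.ball_subset_ball (min_le_left _ _) h1
    have h3 := hs₃ (Metric.ball_subset_ball (min_le_right _ _) h1)
    have h4 := c.mem_of_mem_target (hs₂ h2) y.2
    refine ⟨h2, h3.1, ⟨h3.2, h4⟩, ?_⟩
    have := (c.mem_tangentSpaceAt_iff (hs₁ h3.1) h4 _).1 (hT _ h4)
    simp [hF, hw, this]
  have hFb : ∀ y ∈ Metric.closedBall y₀ a, ‖F y‖ ≤ K₁ * K₃ := fun y hy => by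
    obtain ⟨h1, h2, h3, h4⟩ := hball y hy
    rw [Submodule.coe_norm, h4]
    exact ((fderiv ℝ c.ψ _).le_opNorm _).trans (by gcongr; exacts [hb₁ _ h2, hb₃ _ h3])
  have hFl : ∀ y ∈ Metric.closedBall y₀ a, ∀ z ∈ Metric.closedBall y₀ a,
      ‖F y - F z‖ ≤ 2 * K₁ * K₃ * K₂ * ‖y - z‖ := fun y hy z hz => by
    obtain ⟨h1, h2, h3, h4⟩ := hball y hy
    obtain ⟨g1, g2, g3, g4⟩ := hball z hz
    have hl := hl₂ _ h1 _ g1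
    rw [Submodule.coe_norm, Submodule.coe_sub, h4, g4, Submodule.coe_norm, Submodule.coe_sub]
    set x := c.ψ.symm y
    set x' := c.ψ.symm z
    have e1 : w y - w z = fderiv ℝ c.ψ x (V x - V x') +
        (fderiv ℝ c.ψ x - fderiv ℝ c.ψ x') (V x') := by
      simp [hw, x, x']
    rw [e1]
    calc _ ≤ ‖fderiv ℝ c.ψ x‖ * ‖V x - V x'‖ + ‖fderiv ℝ c.ψ x - fderiv ℝ c.ψ x'‖ * ‖V x'‖ :=
          (norm_add_le _ _).trans (add_le_add (ContinuousLinearMap.le_opNorm _ _)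
            (ContinuousLinearMap.le_opNorm _ _))
      _ ≤ K₁ * (K₃ * ‖x - x'‖) + K₁ * ‖x - x'‖ * K₃ := by
          gcongr
          exacts [hb₁ _ h2, hl₃ _ h3 _ g3, hD₁ _ h2 _ g2, hb₃ _ g3]
      _ = 2 * K₁ * K₃ * ‖x - x'‖ := by ring
      _ ≤ 2 * K₁ * K₃ * (K₂ * ‖(y : X) - z‖) := by gcongr
      _ = _ := by ring
  -- At speed at most `K₁ * K₃` a solution moves at most `a / 2` in time `τ₀`, so starting points
  -- may range over the ball of radius `a / 2`.
  set τ₀ : ℝ := a / 2 / (K₁ * K₃) with hτ₀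
  have hτ₀p : 0 < τ₀ := by positivity
  have hPL : IsPicardLindelof (fun _ : ℝ => F) (tmin := -τ₀) (tmax := τ₀)
      ⟨0, by constructor <;> linarith⟩ y₀ a.toNNReal (a / 2).toNNReal (K₁ * K₃).toNNReal
      (2 * K₁ * K₃ * K₂).toNNReal := by
    refine IsPicardLindelof.of_time_independent ?_ ?_ ?_
    · rw [Real.coe_toNNReal _ hap.le, Real.coe_toNNReal _ (by positivity)]
      exact hFb
    · rw [Real.coe_toNNReal _ hap.le]
      refine LipschitzOnWith.of_dist_le_mul fun y hy z hz => ?_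
      rw [dist_eq_norm, dist_eq_norm, Real.coe_toNNReal _ (by positivity)]
      exact hFl y hy z hz
    · rw [Real.coe_toNNReal _ hap.le, Real.coe_toNNReal _ (by positivity),
        Real.coe_toNNReal _ (by positivity)]
      simp only [sub_zero, zero_sub, neg_neg, max_self, hτ₀]
      rw [mul_div_cancel₀ _ (by positivity)]
      linarith
  obtain ⟨α, hα, hαc⟩ := hPL.exists_forall_mem_closedBall_eq_hasDerivWithinAt_continuousOn
  rw [Real.coe_toNNReal _ (by positivity : 0 ≤ a / 2)] at hα hαc
  have hy₀m : y₀ ∈ Metric.closedBall y₀ (a / 2) := Metric.mem_closedBall_self (by positivity)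
  have hα0 : α (y₀, 0) = y₀ := (hα y₀ hy₀m).1
  have hnh : Metric.closedBall y₀ (a / 2) ×ˢ Icc (-τ₀) τ₀ ∈ 𝓝 (y₀, (0 : ℝ)) :=
    prod_mem_nhds (Metric.closedBall_mem_nhds _ (by positivity))
      (Icc_mem_nhds (by linarith) hτ₀p)
  -- That solutions remain in the ball of radius `a` is recovered from joint continuity at `(y₀,
  -- 0)`, at the cost of a smaller neighbourhood and a shorter time `τ`.
  have hαa : ContinuousAt α (y₀, 0) := hαc.continuousAt hnh
  have hN := hαa.preimage_mem_nhds (by rw [hα0]; exact Metric.closedBall_mem_nhds y₀ hap)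
  obtain ⟨N₁, hN₁, N₂, hN₂, hN₁₂⟩ := mem_nhds_prod_iff.1 (inter_mem hnh hN)
  obtain ⟨τ, hτ, hτN⟩ := Metric.mem_nhds_iff.1 hN₂
  rw [Real.ball_eq_Ioo, zero_sub, zero_add] at hτN
  have hec : ContinuousOn e (c.ψ.source ∩ M) := by
    rw [IsInducing.subtypeVal.continuousOn_iff]
    exact (c.ψ.continuousOn.mono inter_subset_left).congr fun x hx => heM x hx.1 hx.2
  obtain ⟨U, hU, hUe⟩ := mem_nhdsWithin_iff_exists_mem_nhds_inter.1
    ((hec u ⟨hc, hu⟩).preimage_mem_nhdsWithin hN₁)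
  have hin : ∀ x ∈ U ∩ c.ψ.source ∩ M, ∀ t ∈ Ioo (-τ) τ,
      (e x ∈ Metric.closedBall y₀ (a / 2) ∧ t ∈ Icc (-τ₀) τ₀) ∧
      α (e x, t) ∈ Metric.closedBall y₀ a := fun x hx t ht =>
    hN₁₂ (mk_mem_prod (hUe ⟨hx.1.1, hx.1.2, hx.2⟩) (hτN ht))
  have hτ₀N : ∀ x ∈ U ∩ c.ψ.source ∩ M, ∀ t ∈ Ioo (-τ) τ, Icc (-τ₀) τ₀ ∈ 𝓝 t := by
    intro x hx t ht
    filter_upwards [Ioo_mem_nhds ht.1 ht.2] with s hs using (hin x hx s hs).1.2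
  refine ⟨τ, hτ, U ∩ c.ψ.source, inter_mem hU (c.ψ.open_source.mem_nhds hc),
    fun p => c.ψ.symm (α (e p.1, p.2)), fun x hx => ⟨?_, fun t ht => ?_⟩, ?_⟩
  · have h1 := (hα (e x) (hin x hx 0 (by constructor <;> linarith)).1.1).1
    change c.ψ.symm (α (e x, 0)) = x
    have h2 : α (e x, 0) = e x := h1
    rw [h2, heM x hx.1.2 hx.2, c.ψ.left_inv hx.1.2]
  · obtain ⟨⟨h1, h2⟩, h3⟩ := hin x hx t ht
    obtain ⟨g1, g2, g3, g4⟩ := hball _ h3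
    refine ⟨g3.2, ?_⟩
    have d1 : HasDerivAt (fun t => α (e x, t)) (F (α (e x, t))) t :=
      ((hα (e x) h1).2 t h2).hasDerivAt (hτ₀N x hx t ht)
    have d2 : HasDerivAt (fun t => (α (e x, t) : X)) (F (α (e x, t)) : X) t :=
      c.E.subtypeL.hasFDerivAt.comp_hasDerivAt t d1
    have d3 := (c.hasFDerivAt_symm (hs₂ g1)).comp_hasDerivAt t d2
    have e1 : c.ψ (c.ψ.symm (α (e x, t))) = α (e x, t) := c.ψ.right_inv (hs₂ g1)
    have e2 := c.fderiv_symm_fderiv (hs₁ g2) (V (c.ψ.symm (α (e x, t))))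
    rw [e1] at e2
    rw [g4, hw] at d3
    simp only [e2] at d3
    exact d3
  · have c1 : ContinuousOn (fun p : X × ℝ => α (e p.1, p.2))
        ((U ∩ c.ψ.source ∩ M) ×ˢ Ioo (-τ) τ) := by
      refine hαc.comp ?_ fun p hp => ?_
      · refine ContinuousOn.prodMk ?_ continuousOn_snd
        exact hec.comp continuousOn_fst fun p hp => ⟨hp.1.1.2, hp.1.2⟩
      · exact (hin p.1 hp.1 p.2 hp.2).1
    refine c.ψ.symm.continuousOn.comp (continuous_subtype_val.comp_continuousOn c1) fun p hp => ?_
    exact hs₂ (hball _ (hin p.1 hp.1 p.2 hp.2).2).1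

end NCerami

namespace NCerami
variable {X : Type*} [NormedAddCommGroup X] [InnerProductSpace ℝ X]

/-! ### Global flows -/

section Global
variable {V : X → X} {M : Set X}

/-- Every flow line over a bounded interval accumulates in `M` at the end of the interval. -/
def HasEndpoints (V : X → X) (M : Set X) : Prop :=
  ∀ (γ : ℝ → X) (a b : ℝ), a < b → IsFlowLine V M γ (Ioo a b) →
    ∃ y ∈ M, MapClusterPt y (𝓝[<] b) γ

/-- The local flow near the accumulation point `y` has a life span `τ` uniform in its starting
point. Started at `γ s` near `y` with `s > b - τ`, it passes the time `b`; by uniqueness it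
continues `γ`. -/
lemma IsFlowLine.exists_extension (hV : LocallyLipschitzOn M V) (hloc : HasLocalFlow V M)
    (hend : HasEndpoints V M) {γ : ℝ → X} {a b : ℝ} (hab : a < b)
    (hγ : IsFlowLine V M γ (Ioo a b)) :
    ∃ b' > b, ∃ γ', IsFlowLine V M γ' (Ioo a b') ∧ EqOn γ' γ (Ioo a b) := by
  obtain ⟨y, hy, hcl⟩ := hend γ a b hab hγ
  obtain ⟨τ, hτ, U, hU, φ, hφ, -⟩ := hloc y hy
  have hfr := (mapClusterPt_iff_frequently.1 hcl U hU).and_eventually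
    (Ioo_mem_nhdsLT (max_lt hab (sub_lt_self b hτ)))
  obtain ⟨s, hsU, hs⟩ := hfr.exists
  have has : a < s := (le_max_left _ _).trans_lt hs.1
  have hbs : b - τ < s := (le_max_right _ _).trans_lt hs.1
  obtain ⟨h0, hfl⟩ := hφ (γ s) ⟨hsU, (hγ s ⟨has, hs.2⟩).1⟩
  have hfl' : IsFlowLine V M (fun t => φ (γ s, t - s)) (Ioo (s - τ) (s + τ)) :=
    (hfl.comp_sub s).mono fun t ht => ⟨by linarith [ht.1], by linarith [ht.2]⟩
  set γ' : ℝ → X := fun t => if t < b then γ t else φ (γ s, t - s) with hγ'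
  have e1 : EqOn γ' γ (Ioo a b) := fun t ht => by simp [hγ', ht.2]
  have e2 : EqOn γ' (fun t => φ (γ s, t - s)) (Ioo (max a (s - τ)) (s + τ)) := fun t ht => by
    by_cases htb : t < b
    · have key : EqOn γ (fun t => φ (γ s, t - s)) (Ioo (max a (s - τ)) b) :=
        IsFlowLine.eqOn hV (hγ.mono (Ioo_subset_Ioo_left (le_max_left _ _)))
          (hfl'.mono (Ioo_subset_Ioo (le_max_right _ _) (by linarith))) isOpen_Ioo
          isPreconnected_Ioo (t := s) ⟨max_lt has (by linarith), hs.2⟩ (by simp [h0])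
      simp only [hγ', htb, if_true]
      exact key ⟨ht.1, htb⟩
    · simp [hγ', htb]
  refine ⟨s + τ, by linarith, γ', ?_, e1⟩
  refine ((hγ.congr isOpen_Ioo e1).union
    ((hfl'.mono (Ioo_subset_Ioo_left (le_max_right _ _))).congr isOpen_Ioo e2)).mono fun t ht => ?_
  by_cases htb : t < b
  · exact Or.inl ⟨ht.1, htb⟩
  · exact Or.inr ⟨max_lt ht.1 (by linarith), ht.2⟩

/-- By uniqueness any two continuations agree where both are defined, so at each time the value may
be read from an arbitrary one that reaches it. -/
lemma IsFlowLine.exists_glue (hV : LocallyLipschitzOn M V) {γ : ℝ → X} {a b : ℝ} (hab : a < b)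
    {S : Set ℝ} (hS : ∀ b' ∈ S, b ≤ b' ∧
      ∃ γ', IsFlowLine V M γ' (Ioo a b') ∧ EqOn γ' γ (Ioo a b)) :
    ∃ γ', IsFlowLine V M γ' {t | a < t ∧ ∃ b' ∈ S, t < b'} ∧
      ∀ t ∈ Ioo a b, (∃ b' ∈ S, t < b') → γ' t = γ t := by
  classical
  choose! hb Γ hΓ hΓe using hS
  set β : ℝ → ℝ := fun t => if h : ∃ b' ∈ S, t < b' then h.choose else 0 with hβ
  have hβS : ∀ t, (∃ b' ∈ S, t < b') → β t ∈ S ∧ t < β t := fun t h => by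
    simp only [hβ, dif_pos h]; exact h.choose_spec
  have huniq : ∀ b₁ ∈ S, ∀ b₂ ∈ S, ∀ t, a < t → t < b₁ → t < b₂ → Γ b₁ t = Γ b₂ t := by
    intro b₁ h₁ b₂ h₂ t ht ht₁ ht₂
    obtain ⟨m, hm⟩ := exists_between hab
    refine IsFlowLine.eqOn hV ((hΓ b₁ h₁).mono (Ioo_subset_Ioo_right (min_le_left b₁ b₂)))
      ((hΓ b₂ h₂).mono (Ioo_subset_Ioo_right (min_le_right b₁ b₂))) isOpen_Ioo
      isPreconnected_Ioo (t := m) ⟨hm.1, hm.2.trans_le (le_min (hb b₁ h₁) (hb b₂ h₂))⟩ ?_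
      ⟨ht, lt_min ht₁ ht₂⟩
    rw [hΓe b₁ h₁ hm, hΓe b₂ h₂ hm]
  have hloc : ∀ b' ∈ S, EqOn (fun t => Γ (β t) t) (Γ b') (Ioo a b') := fun b' h' t ht => by
    obtain ⟨g1, g2⟩ := hβS t ⟨b', h', ht.2⟩
    exact huniq _ g1 _ h' t ht.1 g2 ht.2
  refine ⟨fun t => Γ (β t) t, ?_, ?_⟩
  · rintro t ⟨hat, b', h', htb'⟩
    exact ((hΓ b' h').congr isOpen_Ioo (hloc b' h')) t ⟨hat, htb'⟩
  · rintro t ht ⟨b', h', htb'⟩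
    exact (hloc b' h' ⟨ht.1, htb'⟩).trans (hΓe b' h' ht)

/-- If the attainable end times were bounded, the glued continuation would reach their supremum and
extend beyond it. -/
lemma IsFlowLine.exists_forward (hV : LocallyLipschitzOn M V) (hloc : HasLocalFlow V M)
    (hend : HasEndpoints V M) {γ : ℝ → X} {a b : ℝ} (hab : a < b)
    (hγ : IsFlowLine V M γ (Ioo a b)) :
    ∃ γ', IsFlowLine V M γ' (Ioi a) ∧ EqOn γ' γ (Ioo a b) := by
  set S : Set ℝ := {b' | b ≤ b' ∧ ∃ γ', IsFlowLine V M γ' (Ioo a b') ∧ EqOn γ' γ (Ioo a b)} with hS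
  have hbS : b ∈ S := ⟨le_rfl, γ, hγ, fun _ _ => rfl⟩
  obtain ⟨γ', hγ', he⟩ := IsFlowLine.exists_glue hV hab (γ := γ) (S := S) fun b' h => h
  have he' : EqOn γ' γ (Ioo a b) := fun t ht => he t ht ⟨b, hbS, ht.2⟩
  by_cases hbdd : BddAbove S
  · exfalso
    have hsup : ∀ t, t < sSup S → ∃ b' ∈ S, t < b' := fun t ht => exists_lt_of_lt_csSup ⟨b, hbS⟩ ht
    have hle := le_csSup hbdd hbS
    obtain ⟨b', hb', γ'', h1, h2⟩ := IsFlowLine.exists_extension hV hloc hend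
      (hab.trans_le hle) (hγ'.mono fun t (ht : t ∈ Ioo a (sSup S)) => ⟨ht.1, hsup t ht.2⟩)
    have : b' ∈ S := ⟨hle.trans (le_of_lt hb'), γ'', h1, fun t ht =>
      (h2 ⟨ht.1, ht.2.trans_le hle⟩).trans (he' ht)⟩
    exact absurd (le_csSup hbdd this) (not_le.2 hb')
  · refine ⟨γ', hγ'.mono fun t ht => ⟨ht, ?_⟩, he'⟩
    by_contra! hcon
    exact hbdd ⟨t, hcon⟩

/-- The past of `u` under `V` is its future under `-V`, whence the hypotheses for both fields. -/
lemma exists_isFlowLine_univ (hV : LocallyLipschitzOn M V) (hloc : HasLocalFlow V M)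
    (hend : HasEndpoints V M) (hV' : LocallyLipschitzOn M fun x => -V x)
    (hloc' : HasLocalFlow (fun x => -V x) M) (hend' : HasEndpoints (fun x => -V x) M)
    {u : X} (hu : u ∈ M) : ∃ γ, γ 0 = u ∧ IsFlowLine V M γ univ := by
  obtain ⟨τ, hτ, U, hU, φ, hφ, -⟩ := hloc u hu
  obtain ⟨h0, hfl⟩ := hφ u ⟨mem_of_mem_nhds hU, hu⟩
  have hτ' : -τ < τ := by linarith
  obtain ⟨γ₁, hγ₁, he₁⟩ := hfl.exists_forward hV hloc hend hτ'
  obtain ⟨γ₂, hγ₂, he₂⟩ := (hfl.comp_neg.mono (J' := Ioo (-τ) τ)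
    fun t ht => ⟨by linarith [ht.2], by linarith [ht.1]⟩).exists_forward hV' hloc' hend' hτ'
  have hγ₂' : IsFlowLine V M (fun t => γ₂ (-t)) (Iio τ) := by
    have := hγ₂.comp_neg.mono (J' := Iio τ) fun t (ht : t < τ) => neg_lt_neg ht
    simpa using this
  set γ : ℝ → X := fun t => if t < 0 then γ₂ (-t) else γ₁ t with hγ
  have e₁ : EqOn γ γ₁ (Ioi (-τ)) := fun t ht => by
    by_cases h : t < 0
    · have h2 := he₂ (x := -t) ⟨by linarith, by linarith [mem_Ioi.1 ht]⟩
      have h1 := he₁ (x := t) ⟨ht, by linarith⟩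
      simp only [hγ, h, if_true]
      rw [h1, h2]
      simp only [neg_neg]
    · simp [hγ, h]
  have e₂ : EqOn γ (fun t => γ₂ (-t)) (Iio 0) := fun t ht => by
    simp [hγ, mem_Iio.1 ht]
  refine ⟨γ, ?_, ?_⟩
  · exact (e₁ (by simpa using hτ)).trans ((he₁ ⟨by linarith, hτ⟩).trans h0)
  · refine ((hγ₁.congr isOpen_Ioi e₁).union
      ((hγ₂'.mono (Iio_subset_Iio hτ.le)).congr isOpen_Iio e₂)).mono fun t _ => ?_
    by_cases h : t < 0
    · exact Or.inr h
    · exact Or.inl (by rw [mem_Ioi]; linarith)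

/-- `φ` is the global flow of `V` on `M`. -/
structure IsGlobalFlow (V : X → X) (M : Set X) (φ : X → ℝ → X) : Prop where
  locallyLipschitzOn : LocallyLipschitzOn M V
  apply_zero : ∀ u ∈ M, φ u 0 = u
  isFlowLine : ∀ u ∈ M, IsFlowLine V M (φ u) univ

lemma exists_isGlobalFlow (hV : LocallyLipschitzOn M V) (hloc : HasLocalFlow V M)
    (hend : HasEndpoints V M) (hV' : LocallyLipschitzOn M fun x => -V x)
    (hloc' : HasLocalFlow (fun x => -V x) M) (hend' : HasEndpoints (fun x => -V x) M) :
    ∃ φ, IsGlobalFlow V M φ := by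
  have h : ∀ u ∈ M, ∃ γ : ℝ → X, γ 0 = u ∧ IsFlowLine V M γ univ := fun u hu =>
    exists_isFlowLine_univ hV hloc hend hV' hloc' hend' hu
  choose! φ h0 hφ using h
  exact ⟨φ, hV, h0, hφ⟩

/-! ### Group law, equivariance and continuity of a global flow -/

namespace IsGlobalFlow
variable {φ : X → ℝ → X} (h : IsGlobalFlow V M φ)
include h

lemma mem {u : X} (hu : u ∈ M) (t : ℝ) : φ u t ∈ M := (h.isFlowLine u hu t trivial).1

lemma hasDerivAt {u : X} (hu : u ∈ M) (t : ℝ) : HasDerivAt (φ u) (V (φ u t)) t :=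
  (h.isFlowLine u hu t trivial).2

lemma continuous {u : X} (hu : u ∈ M) : Continuous (φ u) :=
  continuous_iff_continuousAt.2 fun t => (h.hasDerivAt hu t).continuousAt

lemma eq_of_isFlowLine {γ : ℝ → X} (hγ : IsFlowLine V M γ univ) {s : ℝ} {u : X} (hu : u ∈ M)
    (he : γ s = φ u s) (t : ℝ) : γ t = φ u t :=
  IsFlowLine.eqOn h.locallyLipschitzOn hγ (h.isFlowLine u hu) isOpen_univ isPreconnected_univ
    (mem_univ s) he (mem_univ t)

lemma apply_add {u : X} (hu : u ∈ M) (s t : ℝ) : φ (φ u s) (t - s) = φ u t := by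
  have hs := h.mem hu s
  refine h.eq_of_isFlowLine (γ := fun t => φ (φ u s) (t - s)) (s := s) ?_ hu ?_ t
  · exact ((h.isFlowLine _ hs).comp_sub s).mono fun _ _ => trivial
  · simp [h.apply_zero _ hs]

lemma eq_of_field_eq_zero {u : X} (hu : u ∈ M) {s : ℝ} (hs : V (φ u s) = 0) (t : ℝ) :
    φ u t = φ u s := by
  refine (h.eq_of_isFlowLine (γ := fun _ => φ u s) (s := s) (fun r _ => ⟨h.mem hu s, ?_⟩)
    hu rfl t).symm
  rw [hs]
  exact hasDerivAt_const _ _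

lemma map_eq {L : X →L[ℝ] X} (hL : ∀ x ∈ M, L x ∈ M) (hLV : ∀ x ∈ M, V (L x) = L (V x)) {u : X}
    (hu : u ∈ M) (t : ℝ) : φ (L u) t = L (φ u t) := by
  refine (h.eq_of_isFlowLine (γ := fun t => L (φ u t)) (s := 0) (fun r _ => ⟨hL _ (h.mem hu r), ?_⟩)
    (hL u hu) ?_ t).symm
  · rw [hLV _ (h.mem hu r)]
    exact L.hasFDerivAt.comp_hasDerivAt r (h.hasDerivAt hu r)
  · rw [h.apply_zero u hu, h.apply_zero _ (hL u hu)]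

/-- For fixed `u`, the times `t` at which `φ · t` is continuous at `u` form a clopen set containing
`0`. -/
lemma continuousOn (hloc : HasLocalFlow V M) :
    ContinuousOn (fun p : X × ℝ => φ p.1 p.2) (M ×ˢ univ) := by
  rintro ⟨u, t⟩ ⟨hu, -⟩
  have hu : u ∈ M := hu
  set P : ℝ → Prop := fun t => ContinuousWithinAt (fun p : X × ℝ => φ p.1 p.2) (M ×ˢ univ) (u, t)
  set Q : ℝ → Prop := fun t => ContinuousWithinAt (fun x => φ x t) M u
  have hPQ : ∀ t, P t → Q t := fun t ht =>
    ContinuousWithinAt.comp (f := fun x : X => (x, t)) ht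
      (by fun_prop) fun x hx => ⟨hx, trivial⟩
  -- Near `t₀` the flow is its time-`s` map followed by one local flow around `φ u t₀`, so
  -- continuity at a single time `s` spreads, jointly in time and space, to all times near `t₀`.
  have key : ∀ t₀, ∃ N ∈ 𝓝 t₀, ∀ s ∈ N, ∀ t ∈ N, Q s → P t := by
    intro t₀
    obtain ⟨τ, hτ, U, hU, ψ, hψ, hψc⟩ := hloc (φ u t₀) (h.mem hu t₀)
    have hev : ∀ᶠ s in 𝓝 t₀, U ∈ 𝓝 (φ u s) :=
      (h.continuous hu).continuousAt.eventually (eventually_mem_nhds_iff.2 hU)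
    refine ⟨{s | U ∈ 𝓝 (φ u s)} ∩ Ioo (t₀ - τ / 2) (t₀ + τ / 2),
      inter_mem hev (Ioo_mem_nhds (by linarith) (by linarith)), ?_⟩
    rintro s ⟨hsU, hs⟩ t ⟨-, ht⟩ hQ
    have hsU : U ∈ 𝓝 (φ u s) := hsU
    have hψφ : ∀ x ∈ M, φ x s ∈ U → ∀ t' ∈ Ioo (s - τ) (s + τ), φ x t' = ψ (φ x s, t' - s) := by
      intro x hx hxU t' ht'
      obtain ⟨h0, hfl⟩ := hψ (φ x s) ⟨hxU, h.mem hx s⟩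
      rw [← h.apply_add hx s t']
      exact (IsFlowLine.eqOn h.locallyLipschitzOn hfl
        ((h.isFlowLine _ (h.mem hx s)).mono (subset_univ _)) isOpen_Ioo isPreconnected_Ioo
        (t := 0) ⟨by linarith, hτ⟩ (by rw [h0, h.apply_zero _ (h.mem hx s)])
        (x := t' - s) ⟨by linarith [ht'.1], by linarith [ht'.2]⟩).symm
    have htI : t ∈ Ioo (s - τ) (s + τ) :=
      ⟨by linarith [hs.2, ht.1], by linarith [hs.1, ht.2]⟩
    have hfst : Tendsto Prod.fst (𝓝[M ×ˢ univ] (u, t)) (𝓝[M] u) :=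
      tendsto_nhdsWithin_iff.2 ⟨continuousAt_fst.mono_left nhdsWithin_le_nhds,
        by filter_upwards [self_mem_nhdsWithin] with p hp using hp.1⟩
    have hsnd : Tendsto Prod.snd (𝓝[M ×ˢ univ] (u, t)) (𝓝 t) :=
      continuousAt_snd.mono_left nhdsWithin_le_nhds
    have hqs : Tendsto (fun p : X × ℝ => φ p.1 s) (𝓝[M ×ˢ univ] (u, t)) (𝓝 (φ u s)) :=
      Tendsto.comp hQ hfst
    have hevU : ∀ᶠ p in 𝓝[M ×ˢ univ] (u, t), φ p.1 s ∈ U := hqs hsU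
    have hevt : ∀ᶠ p in 𝓝[M ×ˢ univ] (u, t), p.2 ∈ Ioo (s - τ) (s + τ) :=
      hsnd (Ioo_mem_nhds htI.1 htI.2)
    have hcont : ContinuousWithinAt ψ ((U ∩ M) ×ˢ Ioo (-τ) τ) (φ u s, t - s) :=
      hψc _ ⟨⟨mem_of_mem_nhds hsU, h.mem hu s⟩, by linarith [htI.1], by linarith [htI.2]⟩
    have hlim : Tendsto (fun p : X × ℝ => ψ (φ p.1 s, p.2 - s)) (𝓝[M ×ˢ univ] (u, t))
        (𝓝 (ψ (φ u s, t - s))) := by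
      refine Tendsto.comp hcont (tendsto_nhdsWithin_iff.2 ⟨?_, ?_⟩)
      · exact hqs.prodMk_nhds (hsnd.sub_const s)
      · filter_upwards [hevU, hevt, self_mem_nhdsWithin] with p h1 h2 h3
        exact ⟨⟨h1, h.mem h3.1 s⟩, by linarith [h2.1], by linarith [h2.2]⟩
    change Tendsto _ _ _
    simp only []
    rw [hψφ u hu (mem_of_mem_nhds hsU) t htI]
    refine hlim.congr' ?_
    filter_upwards [hevU, hevt, self_mem_nhdsWithin] with p h1 h2 h3
    exact (hψφ p.1 h3.1 h1 p.2 h2).symm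
  have hclopen : IsClopen {t | Q t} := by
    constructor
    · rw [← isOpen_compl_iff, isOpen_iff_mem_nhds]
      intro t ht
      obtain ⟨N, hN, hNN⟩ := key t
      filter_upwards [hN] with s hs hQ
      exact ht (hPQ _ (hNN s hs t (mem_of_mem_nhds hN) hQ))
    · rw [isOpen_iff_mem_nhds]
      intro t ht
      obtain ⟨N, hN, hNN⟩ := key t
      filter_upwards [hN] with s hs
      exact hPQ _ (hNN t (mem_of_mem_nhds hN) s hs ht)
  have hQ0 : Q 0 := (continuousWithinAt_id (x := u)).congr (fun x hx => h.apply_zero x hx)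
    (h.apply_zero u hu)
  have huniv := hclopen.eq_univ ⟨0, hQ0⟩
  obtain ⟨N, hN, hNN⟩ := key t
  exact hNN t (mem_of_mem_nhds hN) t (mem_of_mem_nhds hN) (huniv.symm ▸ mem_univ t : t ∈ {t | Q t})

end IsGlobalFlow

end Global

end NCerami

namespace NCerami
variable {X : Type*} [NormedAddCommGroup X] [InnerProductSpace ℝ X]
variable {B : X → LinearMap.BilinForm ℝ X} {M : Set X} {Φ : X → ℝ}

/-! ### The functions `N` and `dist_M(·, A)` -/

/-- The triangle inequality for `d` makes `N` an infimum of 1-Lipschitz functions; the length of a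
flow line thus controls the growth of `N` along it. -/
lemma nFun_le_add (u v : X) : nFun B M v ≤ nFun B M u + lengthDist B M u v := by
  unfold nFun
  simp only [ENNReal.iInf_add]
  refine le_iInf₂ fun x hx => (iInf₂_le x hx).trans ?_
  rw [add_assoc]
  gcongr
  exact lengthDist_triangle B M x u v

lemma nFun_ne_top {u : X} (hu : u ∈ M) : nFun B M u ≠ ⊤ := by
  refine ne_top_of_le_ne_top ?_ (iInf₂_le u hu)
  rw [lengthDist_self B hu, add_zero]
  exact ENNReal.ofReal_ne_top

lemma distToSet_le_add (A : Set X) (u v : X) :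
    distToSet B M v A ≤ distToSet B M u A + lengthDist B M u v := by
  unfold distToSet
  simp only [ENNReal.iInf_add]
  refine le_iInf₂ fun x hx => (iInf₂_le x hx).trans ?_
  rw [add_comm, lengthDist_comm B M u v]
  exact lengthDist_triangle B M v u x

/-- The distance to `A` along `M`, truncated at `ρ`. -/
def truncDist (B : X → LinearMap.BilinForm ℝ X) (M A : Set X) (ρ : ℝ) (u : X) : ℝ≥0∞ :=
  min (distToSet B M u A) (ENNReal.ofReal ρ)

lemma truncDist_le_add (A : Set X) (ρ : ℝ) (u v : X) :
    truncDist B M A ρ v ≤ truncDist B M A ρ u + lengthDist B M u v := by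
  unfold truncDist
  rw [← min_add_add_right]
  exact min_le_min (distToSet_le_add A u v) le_self_add

/-- The truncation matters for `toReal`, which sends `∞` to `0`: where `K_c` is empty or cannot be
reached, the cut-off must see a large distance, not zero. -/
lemma truncDist_ne_top (A : Set X) (ρ : ℝ) (u : X) : truncDist B M A ρ u ≠ ⊤ :=
  ne_top_of_le_ne_top ENNReal.ofReal_ne_top (min_le_right _ _)

lemma le_toReal_truncDist_iff {A : Set X} {ρ r : ℝ} (hr : r ≤ ρ) {u : X} :
    r ≤ (truncDist B M A ρ u).toReal ↔ ENNReal.ofReal r ≤ distToSet B M u A := by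
  rw [← ENNReal.ofReal_le_iff_le_toReal (truncDist_ne_top A ρ u), truncDist, le_min_iff]
  exact and_iff_left (ENNReal.ofReal_le_ofReal hr)

lemma toReal_le_toReal_add {f : X → ℝ≥0∞} (hf : ∀ u v, f v ≤ f u + lengthDist B M u v)
    {u v : X} (hu : f u ≠ ⊤) {a : ℝ} (ha : 0 ≤ a) (h : lengthDist B M u v ≤ ENNReal.ofReal a) :
    (f v).toReal ≤ (f u).toReal + a := by
  refine ENNReal.toReal_le_of_le_ofReal (by positivity) ?_
  rw [ENNReal.ofReal_add ENNReal.toReal_nonneg ha, ENNReal.ofReal_toReal hu]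
  exact (hf u v).trans (by gcongr)

/-- Locally `d` is at most a multiple of the norm distance. Used for `N` and for the truncated
distance to `K_c`. -/
lemma IsGradientSetting.locallyLipschitzOn_toReal (h : IsGradientSetting B M Φ)
    {f : X → ℝ≥0∞} (hf : ∀ u v, f v ≤ f u + lengthDist B M u v) (htop : ∀ u ∈ M, f u ≠ ⊤) :
    LocallyLipschitzOn M fun u => (f u).toReal := by
  rw [locallyLipschitzOn_iff]
  intro u hu
  obtain ⟨U, hU, C, hC, hUC⟩ := h.submanifold.exists_lengthDist_le h.equivalent hu (h.ne_zero hu)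
  refine ⟨U, hU, C, hC, fun x hx y hy => abs_sub_le_iff.2 ⟨?_, ?_⟩⟩
  · have := toReal_le_toReal_add hf (htop y hy.2) (by positivity) (hUC y hy x hx)
    rw [norm_sub_rev] at this
    linarith
  · have := toReal_le_toReal_add hf (htop x hx.2) (by positivity) (hUC x hx y hy)
    linarith

lemma IsGradientSetting.tendsto_lengthDist (h : IsGradientSetting B M Φ) {x : ℕ → X}
    (hx : ∀ n, x n ∈ M) {a : X} (ha : a ∈ M) (hlim : Tendsto x atTop (𝓝 a)) :
    Tendsto (fun n => lengthDist B M (x n) a) atTop (𝓝 0) := by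
  obtain ⟨U, hU, C, hC, hUC⟩ := h.submanifold.exists_lengthDist_le h.equivalent ha (h.ne_zero ha)
  have h1 : Tendsto (fun n => ENNReal.ofReal (C * ‖x n - a‖)) atTop (𝓝 0) := by
    have := ENNReal.tendsto_ofReal (((hlim.sub_const a).norm).const_mul C)
    simpa using this
  refine tendsto_of_tendsto_of_tendsto_of_le_of_le' tendsto_const_nhds h1
    (Eventually.of_forall fun _ => bot_le) ?_
  filter_upwards [hlim hU] with n hn
  exact hUC _ ⟨hn, hx n⟩ a ⟨mem_of_mem_nhds hU, ha⟩

lemma IsGradientSetting.tendsto_of_lengthDist (h : IsGradientSetting B M Φ) {x : ℕ → X} {a : X}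
    (ha : a ∈ M) (hlim : Tendsto (fun n => lengthDist B M (x n) a) atTop (𝓝 0)) :
    Tendsto x atTop (𝓝 a) := by
  rw [Metric.tendsto_nhds]
  intro r hr
  obtain ⟨δ, hδ, hδr⟩ := exists_norm_sub_lt_of_lengthDist_lt h.equivalent M (h.ne_zero ha) hr
  filter_upwards [hlim.eventually_lt_const (ENNReal.ofReal_pos.2 hδ)] with n hn
  rw [dist_eq_norm]
  exact hδr _ hn

/-! ### Symmetries -/

/-- A linear isomorphism of `X` that preserves the scalar products, `M` and `Φ`. -/
structure IsSymmetry (B : X → LinearMap.BilinForm ℝ X) (M : Set X) (Φ : X → ℝ)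
    (L : X ≃L[ℝ] X) : Prop where
  map_mem : ∀ u ∈ M, L u ∈ M
  symm_mem : ∀ u ∈ M, L.symm u ∈ M
  form_map : ∀ u ∈ M, ∀ v w, B (L u) (L v) (L w) = B u v w
  apply_map : ∀ u ∈ M, Φ (L u) = Φ u

namespace IsSymmetry
variable {L : X ≃L[ℝ] X} (hL : IsSymmetry B M Φ L)
include hL

lemma symm : IsSymmetry B M Φ L.symm where
  map_mem := hL.symm_mem
  symm_mem u hu := by simpa using hL.map_mem u hu
  form_map u hu v w := by
    simpa using (hL.form_map _ (hL.symm_mem u hu) (L.symm v) (L.symm w)).symm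
  apply_map u hu := by simpa using (hL.apply_map _ (hL.symm_mem u hu)).symm

lemma normAt_map {u : X} (hu : u ∈ M) (v : X) : normAt B (L u) (L v) = normAt B u v := by
  unfold normAt
  rw [hL.form_map u hu]

lemma lengthDist_map_le (u v : X) : lengthDist B M (L u) (L v) ≤ lengthDist B M u v := by
  refine le_of_forall_gt fun r hr => ?_
  obtain ⟨γ, hγ, hM, rfl, rfl, hlt⟩ := exists_curve_of_lengthDist_lt hr
  refine (lengthDist_le_curveLength B (γ := fun s => L (γ s)) (L.contDiff.comp_contDiffOn hγ)
    fun s hs => hL.map_mem _ (hM hs)).trans_lt (lt_of_eq_of_lt ?_ hlt)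
  refine MeasureTheory.setLIntegral_congr_fun measurableSet_Icc fun s hs => ?_
  have h1 : HasDerivWithinAt (fun s => L (γ s)) (L (derivWithin γ (Icc 0 1) s)) (Icc 0 1) s :=
    L.toContinuousLinearMap.hasFDerivAt.comp_hasDerivWithinAt s
      (hγ.differentiableOn one_ne_zero s hs).hasDerivWithinAt
  simp only [h1.derivWithin (uniqueDiffOn_Icc zero_lt_one s hs), hL.normAt_map (hM hs)]

lemma lengthDist_map (u v : X) : lengthDist B M (L u) (L v) = lengthDist B M u v :=
  le_antisymm (hL.lengthDist_map_le u v) (by simpa using hL.symm.lengthDist_map_le (L u) (L v))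

lemma map_mem_tangentSpaceAt {u v : X} (hv : v ∈ tangentSpaceAt M u) :
    L v ∈ tangentSpaceAt M (L u) := by
  have : tangentSpaceAt M u ≤ (tangentSpaceAt M (L u)).comap L.toLinearMap := by
    refine Submodule.span_le.2 fun v ⟨γ, h1, h2, h3⟩ => Submodule.subset_span
      ⟨fun t => L (γ t), ?_, congrArg L h2, ?_⟩
    · filter_upwards [h1] with t ht using hL.map_mem _ ht
    · exact L.toContinuousLinearMap.hasFDerivAt.comp_hasDerivAt 0 h3
  exact this hv

lemma derivOn_map (h : IsGradientSetting B M Φ) {u v : X} (hu : u ∈ M)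
    (hv : v ∈ tangentSpaceAt M u) : derivOn M Φ (L u) (L v) = derivOn M Φ u v := by
  obtain ⟨γ, hγM, rfl, hγ⟩ := h.submanifold.exists_curve_of_mem_tangentSpaceAt hu hv
  have h1 := h.c11.hasDerivAt_comp hγM hγ
  have hev : ∀ᶠ t in 𝓝 (0 : ℝ), L (γ t) ∈ M := by
    filter_upwards [hγM] with t ht using hL.map_mem _ ht
  have h2 := h.c11.hasDerivAt_comp hev (L.toContinuousLinearMap.hasFDerivAt.comp_hasDerivAt 0 hγ)
  refine h2.unique (h1.congr_of_eventuallyEq ?_)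
  filter_upwards [hγM] with t ht using hL.apply_map _ ht

lemma isGradientAt_map (h : IsGradientSetting B M Φ) {u w : X} (hu : u ∈ M)
    (hw : IsGradientAt B M Φ u w) : IsGradientAt B M Φ (L u) (L w) := by
  refine ⟨hL.map_mem_tangentSpaceAt hw.1, fun v hv => ?_⟩
  have hv' : L.symm v ∈ tangentSpaceAt M u := by
    simpa using hL.symm.map_mem_tangentSpaceAt hv
  have h1 := hL.derivOn_map h hu hv'
  have h2 := hL.form_map u hu w (L.symm v)
  rw [L.apply_symm_apply] at h1 h2
  rw [h1, h2, hw.2 _ hv']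

lemma gradOn_map [CompleteSpace X] (h : IsGradientSetting B M Φ) {u : X} (hu : u ∈ M) :
    gradOn B M Φ (L u) = L (gradOn B M Φ u) :=
  h.gradOn_eq (hL.map_mem u hu) (hL.isGradientAt_map h hu (h.isGradientAt_gradOn hu))

lemma form_gradOn_map [CompleteSpace X] (h : IsGradientSetting B M Φ) {u : X} (hu : u ∈ M) :
    B (L u) (gradOn B M Φ (L u)) (gradOn B M Φ (L u)) =
      B u (gradOn B M Φ u) (gradOn B M Φ u) := by
  rw [hL.gradOn_map h hu, hL.form_map u hu]

lemma map_mem_criticalSetAt (h : IsGradientSetting B M Φ) {c : ℝ} {u : X}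
    (hu : u ∈ criticalSetAt M Φ c) : L u ∈ criticalSetAt M Φ c := by
  obtain ⟨⟨huM, hcrit⟩, hc⟩ := hu
  refine ⟨⟨hL.map_mem u huM, fun v hv => ?_⟩, by rw [hL.apply_map u huM, hc]⟩
  have hv' : L.symm v ∈ tangentSpaceAt M u := by
    simpa using hL.symm.map_mem_tangentSpaceAt hv
  have h1 := hL.derivOn_map h huM hv'
  rw [L.apply_symm_apply] at h1
  rw [h1, hcrit _ hv']

lemma distToSet_map_le (h : IsGradientSetting B M Φ) (c : ℝ) (u : X) :
    distToSet B M (L u) (criticalSetAt M Φ c) ≤ distToSet B M u (criticalSetAt M Φ c) := by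
  refine le_iInf₂ fun a ha => (iInf₂_le (L a) (hL.map_mem_criticalSetAt h ha)).trans ?_
  exact hL.lengthDist_map_le u a

lemma distToSet_map (h : IsGradientSetting B M Φ) (c : ℝ) (u : X) :
    distToSet B M (L u) (criticalSetAt M Φ c) = distToSet B M u (criticalSetAt M Φ c) :=
  le_antisymm (hL.distToSet_map_le h c u) (by simpa using hL.symm.distToSet_map_le h c (L u))

lemma nFun_map_le (u : X) : nFun B M (L u) ≤ nFun B M u := by
  refine le_iInf₂ fun x hx => (iInf₂_le (L x) (hL.map_mem x hx)).trans ?_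
  rw [hL.normAt_map hx, hL.lengthDist_map]

lemma nFun_map (u : X) : nFun B M (L u) = nFun B M u :=
  le_antisymm (hL.nFun_map_le u) (by simpa using hL.symm.nFun_map_le (L u))

end IsSymmetry

end NCerami

namespace NCerami
variable {X : Type*} [NormedAddCommGroup X] [InnerProductSpace ℝ X]
variable {B : X → LinearMap.BilinForm ℝ X} {M : Set X} {Φ : X → ℝ}

/-! ### Flow lines with speed bounded by `A (1 + N)` -/

lemma IsFlowLine.lengthDist_le {V : X → X} (hV : LocallyLipschitzOn M V) {γ : ℝ → X} {J : Set ℝ}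
    (hγ : IsFlowLine V M γ J) {s t L : ℝ} (hJ : uIcc s t ⊆ J)
    (hL : ∀ r ∈ uIcc s t, normAt B (γ r) (V (γ r)) ≤ L) :
    lengthDist B M (γ s) (γ t) ≤ ENNReal.ofReal (L * |t - s|) :=
  lengthDist_le_of_speed_le B (γ' := fun r => V (γ r)) (fun r hr => (hγ r (hJ hr)).2)
    (hV.continuousOn.comp (hγ.continuousOn.mono hJ) fun r hr => (hγ r (hJ hr)).1)
    (fun r hr => (hγ r (hJ hr)).1) hL

/-- The speed grows at most linearly in the 1-Lipschitz function `N`, so a Gronwall-type argument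
bounds `N`, hence the speed, near the end time. The line is then `d`-Cauchy, and completeness of the
strip gives its limit. -/
lemma IsGradientSetting.hasEndpoints (h : IsGradientSetting B M Φ) {V : X → X}
    (hV : LocallyLipschitzOn M V) {A : ℝ} (hA : 0 < A)
    (hspeed : ∀ u ∈ M, normAt B u (V u) ≤ A * (1 + (nFun B M u).toReal)) {I : Set ℝ}
    (hcomplete : IsLengthComplete B M {u | u ∈ M ∧ Φ u ∈ I})
    (hzero : ∀ u ∈ M, Φ u ∉ I → V u = 0) : HasEndpoints V M := by
  intro γ a b hab hγ
  by_cases hcase : ∃ s ∈ Ioo a b, Φ (γ s) ∉ I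
  · obtain ⟨s, hs, hsI⟩ := hcase
    -- Outside the strip the field vanishes, so by uniqueness a line that meets such a point is
    -- constant.
    have hconst : IsFlowLine V M (fun _ => γ s) (Ioo a b) := fun t _ => by
      refine ⟨(hγ s hs).1, ?_⟩
      rw [hzero _ (hγ s hs).1 hsI]
      exact hasDerivAt_const _ _
    have heq := IsFlowLine.eqOn hV hγ hconst isOpen_Ioo isPreconnected_Ioo hs rfl
    refine ⟨γ s, (hγ s hs).1, Filter.Tendsto.mapClusterPt ?_⟩
    refine tendsto_const_nhds.congr' ?_
    filter_upwards [Ioo_mem_nhdsLT hab] with t ht using (heq ht).symm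
  push Not at hcase
  obtain ⟨s, hs, hsA⟩ : ∃ s ∈ Ioo a b, A * (b - s) ≤ 1 / 2 := by
    refine ⟨max ((a + b) / 2) (b - 1 / (2 * A)), ⟨lt_max_of_lt_left (by linarith),
      max_lt (by linarith) (sub_lt_self _ (by positivity))⟩, ?_⟩
    have : b - max ((a + b) / 2) (b - 1 / (2 * A)) ≤ 1 / (2 * A) := by
      linarith [le_max_right ((a + b) / 2) (b - 1 / (2 * A))]
    calc _ ≤ A * (1 / (2 * A)) := by gcongr
      _ = 1 / 2 := by field_simp
  set f : ℝ → ℝ := fun t => (nFun B M (γ t)).toReal with hf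
  have hf0 : ∀ t, 0 ≤ f t := fun t => ENNReal.toReal_nonneg
  have hfc : ContinuousOn f (Ioo a b) :=
    (h.locallyLipschitzOn_toReal nFun_le_add fun u hu => nFun_ne_top hu).continuousOn.comp
      hγ.continuousOn fun t ht => (hγ t ht).1
  -- At a maximum point `r` of `f` on `[s,t]`, `f r ≤ f s + A (1 + f r)(r - s) ≤ f s + (1 + f r)/2`,
  -- and `f r` is absorbed on the left.
  have hbound : ∀ t ∈ Ico s b, f t ≤ 2 * f s + 1 := by
    intro t ht
    have hst : Icc s t ⊆ Ioo a b := fun r hr => ⟨hs.1.trans_le hr.1, hr.2.trans_lt ht.2⟩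
    obtain ⟨r, hr, hmax⟩ := isCompact_Icc.exists_isMaxOn ⟨s, left_mem_Icc.2 ht.1⟩ (hfc.mono hst)
    have hsub : uIcc s r ⊆ Icc s t := by
      rw [uIcc_of_le hr.1]; exact Icc_subset_Icc_right hr.2
    have hd := hγ.lengthDist_le (B := B) hV (s := s) (t := r) (L := A * (1 + f r))
      (hsub.trans hst) fun q hq => (hspeed _ (hγ q (hst (hsub hq))).1).trans (by
        gcongr; exact hmax (hsub hq))
    have h1 := toReal_le_toReal_add nFun_le_add (nFun_ne_top (hγ s hs).1)
      (mul_nonneg (mul_nonneg hA.le (by linarith [hf0 r])) (abs_nonneg (r - s))) hd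
    rw [abs_of_nonneg (sub_nonneg.2 hr.1)] at h1
    have h2 : f r ≤ f s + A * (1 + f r) * (r - s) := h1
    have h3 : A * (r - s) ≤ 1 / 2 := le_trans (by gcongr; linarith [hr.2, ht.2]) hsA
    have h4 : f t ≤ f r := hmax (right_mem_Icc.2 ht.1)
    nlinarith [hf0 r]
  set K := A * (1 + (2 * f s + 1)) with hK
  have hKp : 0 < K := by have := hf0 s; positivity
  have hdist : ∀ t ∈ Ico s b, ∀ t' ∈ Ico s b,
      lengthDist B M (γ t) (γ t') ≤ ENNReal.ofReal (K * |t' - t|) := by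
    intro t ht t' ht'
    have hsub : uIcc t t' ⊆ Ico s b := ordConnected_Ico.uIcc_subset ht ht'
    refine hγ.lengthDist_le hV (hsub.trans fun r hr => ⟨hs.1.trans_le hr.1, hr.2⟩) fun r hr => ?_
    have hr' := hsub hr
    refine (hspeed _ (hγ r ⟨hs.1.trans_le hr'.1, hr'.2⟩).1).trans ?_
    rw [hK]
    gcongr
    exact hbound r hr'
  set x : ℕ → ℝ := fun n => b - (b - s) * (1 / ((n : ℝ) + 1)) with hx
  have hbs : 0 < b - s := sub_pos.2 hs.2
  have hxm : ∀ n, x n ∈ Ico s b := fun n => by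
    have h1 : 1 / ((n : ℝ) + 1) ≤ 1 := by
      rw [div_le_one (by positivity)]; linarith [Nat.cast_nonneg (α := ℝ) n]
    have h2 : 0 < 1 / ((n : ℝ) + 1) := by positivity
    constructor <;> simp only [hx] <;> nlinarith
  have hxI : ∀ n, x n ∈ Ioo a b := fun n => ⟨hs.1.trans_le (hxm n).1, (hxm n).2⟩
  have hxlim : Tendsto x atTop (𝓝 b) := by
    have := (tendsto_one_div_add_atTop_nhds_zero_nat (𝕜 := ℝ)).const_mul (b - s)
    rw [mul_zero] at this
    simpa only [sub_zero] using! this.const_sub b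
  obtain ⟨y, hy, hylim⟩ := hcomplete (fun n => γ (x n))
    (fun n => ⟨(hγ _ (hxI n)).1, hcase _ (hxI n)⟩) (by
      intro δ hδ
      obtain ⟨δ', hδ', hδδ'⟩ : ∃ δ' : ℝ, 0 < δ' ∧ ENNReal.ofReal δ' ≤ δ := by
        rcases eq_or_ne δ ⊤ with rfl | hne
        · exact ⟨1, one_pos, le_top⟩
        · exact ⟨δ.toReal, ENNReal.toReal_pos hδ.ne' hne, ENNReal.ofReal_toReal_le⟩
      obtain ⟨n₀, hn₀⟩ := Metric.cauchySeq_iff.1 hxlim.cauchySeq (δ' / K) (by positivity)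
      refine ⟨n₀, fun m hm n hn => (hdist _ (hxm m) _ (hxm n)).trans_lt
        (lt_of_lt_of_le ?_ hδδ')⟩
      rw [ENNReal.ofReal_lt_ofReal_iff hδ']
      have := hn₀ n hn m hm
      rw [Real.dist_eq, lt_div_iff₀ hKp] at this
      linarith)
  refine ⟨y, hy.1, MapClusterPt.of_comp (φ := x) (p := atTop) ?_
    (h.tendsto_of_lengthDist hy.1 hylim).mapClusterPt⟩
  exact tendsto_nhdsWithin_iff.2 ⟨hxlim, Eventually.of_forall fun n => (hxm n).2⟩

lemma normAt_neg (u v : X) : normAt B u (-v) = normAt B u v := by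
  simpa using normAt_smul B u (-1) v

/-- The flow of a field `-κ ∇Φ` with a locally Lipschitz factor `κ` supported in `Φ⁻¹(I)`. -/
lemma IsGradientSetting.exists_isGlobalFlow [CompleteSpace X] (h : IsGradientSetting B M Φ)
    {κ : X → ℝ} (hκ : LocallyLipschitzOn M κ) {A : ℝ} (hA : 0 < A)
    (hspeed : ∀ u ∈ M, |κ u| * normAt B u (gradOn B M Φ u) ≤ A * (1 + (nFun B M u).toReal))
    {I : Set ℝ} (hcomplete : IsLengthComplete B M {u | u ∈ M ∧ Φ u ∈ I})
    (hzero : ∀ u ∈ M, Φ u ∉ I → κ u = 0) :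
    ∃ φ, IsGlobalFlow (fun u => -(κ u • gradOn B M Φ u)) M φ ∧
      HasLocalFlow (fun u => -(κ u • gradOn B M Φ u)) M := by
  have hV' : LocallyLipschitzOn M fun u => κ u • gradOn B M Φ u :=
    LocallyLipschitzOn.smul_fun hκ h.locallyLipschitzOn_gradOn
  have hV : LocallyLipschitzOn M fun u => -(κ u • gradOn B M Φ u) := by
    simpa using LocallyLipschitzOn.smul_fun (f := fun _ : X => (-1 : ℝ))
      (LocallyLipschitz.const (-1)).locallyLipschitzOn hV'
  have hT' : ∀ u ∈ M, κ u • gradOn B M Φ u ∈ tangentSpaceAt M u := fun u hu =>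
    Submodule.smul_mem _ _ (h.isGradientAt_gradOn hu).1
  have hs' : ∀ u ∈ M, normAt B u (κ u • gradOn B M Φ u) ≤ A * (1 + (nFun B M u).toReal) :=
    fun u hu => by rw [normAt_smul]; exact hspeed u hu
  have hz' : ∀ u ∈ M, Φ u ∉ I → κ u • gradOn B M Φ u = 0 := fun u hu hI => by
    rw [hzero u hu hI, zero_smul]
  have hloc : HasLocalFlow (fun u => -(κ u • gradOn B M Φ u)) M :=
    h.submanifold.hasLocalFlow hV fun u hu => Submodule.neg_mem _ (hT' u hu)
  have hend : HasEndpoints (fun u => -(κ u • gradOn B M Φ u)) M :=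
    h.hasEndpoints hV hA (fun u hu => by rw [normAt_neg]; exact hs' u hu) hcomplete
      fun u hu hI => by rw [hz' u hu hI, neg_zero]
  obtain ⟨φ, hφ⟩ := NCerami.exists_isGlobalFlow hV hloc hend (by simpa using hV')
    (by simpa using h.submanifold.hasLocalFlow hV' hT')
    (by simpa using h.hasEndpoints hV' hA hs' hcomplete hz')
  exact ⟨φ, hφ, hloc⟩

/-! ### Consequences of the Cerami condition -/

lemma IsGradientSetting.mem_criticalSet_of_gradOn_eq_zero [CompleteSpace X]
    (h : IsGradientSetting B M Φ) {u : X} (hu : u ∈ M) (h0 : gradOn B M Φ u = 0) :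
    u ∈ criticalSet M Φ := by
  refine ⟨hu, fun v hv => ?_⟩
  rw [(h.isGradientAt_gradOn hu).2 v hv, h0]
  simp

lemma IsGradientSetting.gradOn_eq_zero [CompleteSpace X]
    (h : IsGradientSetting B M Φ) {u : X} (hu : u ∈ criticalSet M Φ) : gradOn B M Φ u = 0 :=
  h.gradOn_eq hu.1 ⟨Submodule.zero_mem _, fun v hv => by rw [hu.2 v hv]; simp⟩

section Cerami
variable {G : Type*} [SMul G X]

/-- After translation by the group, a subsequence of an `N`-Cerami sequence converges to a critical
point. -/
lemma IsGradientSetting.exists_symmetry_tendsto [CompleteSpace X] (h : IsGradientSetting B M Φ)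
    (hsym : ∀ g : G, ∃ L : X ≃L[ℝ] X, IsSymmetry B M Φ L ∧ ∀ x, L x = g • x) {c : ℝ}
    (hNCG : NCGCondition G B M Φ c) {u : ℕ → X} (hu : ∀ n, u n ∈ M)
    (hΦu : Tendsto (fun n => Φ (u n)) atTop (𝓝 c))
    (hgrad : Tendsto (fun n => ENNReal.ofReal (normAt B (u n) (gradOn B M Φ (u n))) *
      (1 + nFun B M (u n))) atTop (𝓝 0)) :
    ∃ (k : ℕ → ℕ) (L : ℕ → X ≃L[ℝ] X), StrictMono k ∧ (∀ n, IsSymmetry B M Φ (L n)) ∧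
      ∃ a ∈ criticalSetAt M Φ c,
        Tendsto (fun n => lengthDist B M (L n (u (k n))) a) atTop (𝓝 0) := by
  obtain ⟨k, hk, g, a, ha, hlim⟩ := hNCG u ⟨hu, hΦu, fun n => gradOn B M Φ (u n),
    fun n => h.isGradientAt_gradOn (hu n), hgrad⟩
  choose L hL hLg using fun n => hsym (g n)
  have hlim' : Tendsto (fun n => L n (u (k n))) atTop (𝓝 a) := by simpa [hLg] using hlim
  have hmem : ∀ n, L n (u (k n)) ∈ M := fun n => (hL n).map_mem _ (hu _)
  have hwithin : Tendsto (fun n => L n (u (k n))) atTop (𝓝[M] a) :=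
    tendsto_nhdsWithin_iff.2 ⟨hlim', Eventually.of_forall hmem⟩
  have hΦa : Φ a = c := by
    refine tendsto_nhds_unique ((h.c11.continuousOn a ha).tendsto.comp hwithin) ?_
    refine (hΦu.comp hk.tendsto_atTop).congr fun n => ?_
    exact ((hL n).apply_map _ (hu _)).symm
  have hq : Tendsto (fun n => normAt B (u n) (gradOn B M Φ (u n))) atTop (𝓝 0) := by
    have h1 : Tendsto (fun n => ENNReal.ofReal (normAt B (u n) (gradOn B M Φ (u n)))) atTop
        (𝓝 0) := by
      refine tendsto_of_tendsto_of_tendsto_of_le_of_le tendsto_const_nhds hgrad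
        (fun _ => bot_le) fun n => ?_
      exact le_mul_of_one_le_right bot_le le_self_add
    have h2 := (ENNReal.tendsto_toReal ENNReal.zero_ne_top).comp h1
    refine (h2.congr fun n => ?_)
    simp [ENNReal.toReal_ofReal (normAt_nonneg _ _ _)]
  -- The symmetries preserve `‖∇Φ‖`, so the translated points also have gradients tending to zero,
  -- and continuity passes this to `a`.
  have hqa : B a (gradOn B M Φ a) (gradOn B M Φ a) = 0 := by
    have hc := (h.locallyLipschitzOn_apply_self h.locallyLipschitzOn_gradOn).continuousOn a ha
    refine tendsto_nhds_unique (hc.tendsto.comp hwithin) ?_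
    have h3 := (hq.comp hk.tendsto_atTop).pow 2
    rw [zero_pow two_ne_zero] at h3
    refine h3.congr fun n => ?_
    simp only [Function.comp]
    rw [(hL n).form_gradOn_map h (hu _), h.isScalarProductFamily.normAt_sq (h.ne_zero (hu _))]
  have hga : gradOn B M Φ a = 0 := by
    by_contra hne
    exact ((h.isScalarProductFamily a (h.ne_zero ha)).2 _ hne).ne' hqa
  exact ⟨k, L, hk, hL, a, ⟨h.mem_criticalSet_of_gradOn_eq_zero ha hga, hΦa⟩,
    h.tendsto_lengthDist hmem ha hlim'⟩

/-- Away from `K_c` the Cerami quantity is bounded below near the level `c`. -/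
lemma IsGradientSetting.exists_cerami_lower_bound [CompleteSpace X] (h : IsGradientSetting B M Φ)
    (hsym : ∀ g : G, ∃ L : X ≃L[ℝ] X, IsSymmetry B M Φ L ∧ ∀ x, L x = g • x) {c : ℝ}
    (hNCG : NCGCondition G B M Φ c) {r : ℝ} (hr : 0 < r) :
    ∃ ε > 0, ∃ δ > 0, ∀ u ∈ M, |Φ u - c| ≤ ε →
      ENNReal.ofReal r ≤ distToSet B M u (criticalSetAt M Φ c) →
      δ ≤ normAt B u (gradOn B M Φ u) * (1 + (nFun B M u).toReal) := by
  by_contra! hcon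
  have hpos : ∀ n : ℕ, (0 : ℝ) < 1 / ((n : ℝ) + 1) := fun n => by positivity
  choose u hu hΦu hdu hlt using fun n : ℕ => hcon _ (hpos n) _ (hpos n)
  have h0 := tendsto_one_div_add_atTop_nhds_zero_nat (𝕜 := ℝ)
  obtain ⟨k, L, hk, hL, a, ha, hlim⟩ := h.exists_symmetry_tendsto hsym hNCG hu
    (by
      rw [tendsto_iff_norm_sub_tendsto_zero]
      exact squeeze_zero (fun _ => norm_nonneg _) hΦu h0)
    (by
      have h1 := ENNReal.tendsto_ofReal h0
      rw [ENNReal.ofReal_zero] at h1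
      refine tendsto_of_tendsto_of_tendsto_of_le_of_le tendsto_const_nhds h1
        (fun _ => bot_le) fun n => ?_
      refine le_trans (le_of_eq ?_) (ENNReal.ofReal_le_ofReal (hlt n).le)
      rw [ENNReal.ofReal_mul (normAt_nonneg _ _ _),
        ENNReal.ofReal_add zero_le_one ENNReal.toReal_nonneg, ENNReal.ofReal_one,
        ENNReal.ofReal_toReal (nFun_ne_top (hu n))])
  obtain ⟨n, hn⟩ := (hlim.eventually_lt_const (ENNReal.ofReal_pos.2 hr)).exists
  refine absurd (hdu (k n)) (not_le.2 ?_)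
  -- The distance to `K_c` is invariant, so it may be measured after translation, close to `a ∈
  -- K_c`.
  rw [← (hL n).distToSet_map h]
  exact (iInf₂_le a ha).trans_lt hn

/-- The function `N` is bounded on `K_c`. -/
lemma IsGradientSetting.exists_nFun_le [CompleteSpace X] (h : IsGradientSetting B M Φ)
    (hsym : ∀ g : G, ∃ L : X ≃L[ℝ] X, IsSymmetry B M Φ L ∧ ∀ x, L x = g • x) {c : ℝ}
    (hNCG : NCGCondition G B M Φ c) :
    ∃ R : ℝ, 0 < R ∧ ∀ u ∈ criticalSetAt M Φ c, (nFun B M u).toReal ≤ R := by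
  by_contra! hcon
  have hpos : ∀ n : ℕ, (0 : ℝ) < (n : ℝ) + 1 := fun n => by positivity
  choose u hu hlt using fun n : ℕ => hcon _ (hpos n)
  have huM : ∀ n, u n ∈ M := fun n => (hu n).1.1
  -- Points of `K_c` form an `N`-Cerami sequence however large `N` is, because the gradient vanishes
  -- exactly. By invariance `N (u (k n)) ≤ N a + 1` eventually.
  obtain ⟨k, L, hk, hL, a, ha, hlim⟩ := h.exists_symmetry_tendsto hsym hNCG huM
    (tendsto_const_nhds.congr fun n => (hu n).2.symm)
    (tendsto_const_nhds.congr fun n => by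
      rw [h.gradOn_eq_zero (hu n).1, normAt_zero, ENNReal.ofReal_zero, zero_mul])
  obtain ⟨m, hm⟩ := exists_nat_ge ((nFun B M a).toReal + 1)
  obtain ⟨n, hn, hmn⟩ := ((hlim.eventually_lt_const (ENNReal.ofReal_pos.2 one_pos)).and
    (eventually_ge_atTop m)).exists
  have h1 := toReal_le_toReal_add nFun_le_add (nFun_ne_top ha.1.1) zero_le_one
    (by rw [lengthDist_comm]; exact hn.le)
  rw [(hL n).nFun_map] at h1
  have h2 := hlt (k n)
  have h3 : (m : ℝ) ≤ k n := by exact_mod_cast hmn.trans (hk.id_le n)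
  linarith

end Cerami

end NCerami

namespace NCerami
variable {X : Type*} [NormedAddCommGroup X] [InnerProductSpace ℝ X]
variable {B : X → LinearMap.BilinForm ℝ X} {M : Set X} {Φ : X → ℝ}

/-! ### The deformation -/

/-- Truncation of a real number to the unit interval. -/
def clampUnit (s : ℝ) : ℝ := max 0 (min 1 s)

lemma clampUnit_nonneg (s : ℝ) : 0 ≤ clampUnit s := le_max_left _ _

lemma clampUnit_le_one (s : ℝ) : clampUnit s ≤ 1 := max_le zero_le_one (min_le_left _ _)

lemma clampUnit_of_nonpos {s : ℝ} (hs : s ≤ 0) : clampUnit s = 0 :=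
  max_eq_left ((min_le_right _ _).trans hs)

lemma clampUnit_of_one_le {s : ℝ} (hs : 1 ≤ s) : clampUnit s = 1 := by
  rw [clampUnit, min_eq_left hs, max_eq_right zero_le_one]

lemma abs_clampUnit_sub_le (a b : ℝ) : |clampUnit a - clampUnit b| ≤ |a - b| := by
  refine (abs_max_sub_max_le_max 0 _ 0 _).trans (max_le (by simp) ?_)
  exact (abs_min_sub_min_le_max 1 a 1 b).trans (max_le (by simp) le_rfl)

/-- The squared norm of the gradient, bounded below by `(δ / (1 + N))²`. -/
def gradSqMax (B : X → LinearMap.BilinForm ℝ X) (M : Set X) (Φ : X → ℝ) (δ : ℝ) (u : X) : ℝ :=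
  max (B u (gradOn B M Φ u) (gradOn B M Φ u))
    (δ * (1 + (nFun B M u).toReal)⁻¹ * (δ * (1 + (nFun B M u).toReal)⁻¹))

/-- The factor `κ` in the deformation field `-κ ∇Φ`. -/
def flowFactor (B : X → LinearMap.BilinForm ℝ X) (M : Set X) (Φ : X → ℝ) (c ρ δ ε : ℝ)
    (u : X) : ℝ :=
  2 * ε * clampUnit (2 - |Φ u - c| / ε) *
    clampUnit (4 * (truncDist B M (criticalSetAt M Φ c) ρ u).toReal / ρ - 1) *
    (gradSqMax B M Φ δ u)⁻¹

/-! ### Estimates for the deformation field and its flow -/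

section FlowFactor
variable {c ρ δ ε : ℝ}

lemma one_add_nFun_pos (u : X) : 0 < 1 + (nFun B M u).toReal := by
  have : 0 ≤ (nFun B M u).toReal := ENNReal.toReal_nonneg
  linarith

lemma gradSqMax_pos (hδ : 0 < δ) (u : X) : 0 < gradSqMax B M Φ δ u := by
  refine lt_max_of_lt_right ?_
  have := one_add_nFun_pos (B := B) (M := M) u
  positivity

lemma flowFactor_nonneg (hδ : 0 < δ) (hε : 0 < ε) (u : X) :
    0 ≤ flowFactor B M Φ c ρ δ ε u := by
  have h1 := clampUnit_nonneg (2 - |Φ u - c| / ε)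
  have h2 := clampUnit_nonneg
    (4 * (truncDist B M (criticalSetAt M Φ c) ρ u).toReal / ρ - 1)
  have h3 := gradSqMax_pos (B := B) (M := M) (Φ := Φ) hδ u
  unfold flowFactor
  positivity

lemma flowFactor_eq_zero (hε : 0 < ε) {u : X} (hu : Φ u ∉ Icc (c - 2 * ε) (c + 2 * ε)) :
    flowFactor B M Φ c ρ δ ε u = 0 := by
  have h1 : 2 * ε < |Φ u - c| := by
    by_contra! hcon
    exact hu ⟨by linarith [(abs_le.1 hcon).1], by linarith [(abs_le.1 hcon).2]⟩
  have h2 : clampUnit (2 - |Φ u - c| / ε) = 0 := by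
    refine clampUnit_of_nonpos (sub_nonpos.2 ?_)
    rw [le_div_iff₀ hε]
    exact h1.le
  simp [flowFactor, h2]

namespace IsGradientSetting
variable (h : IsGradientSetting B M Φ)
include h

/-- The delicate factor is the reciprocal; its denominator is positive even at critical points,
thanks to the maximum with `(δ/(1+N))²`. -/
lemma locallyLipschitzOn_flowFactor [CompleteSpace X] (hρ : 0 < ρ) (hδ : 0 < δ) (hε : 0 < ε) :
    LocallyLipschitzOn M (flowFactor B M Φ c ρ δ ε) := by
  have h1 : LocallyLipschitzOn M fun u => clampUnit (2 - |Φ u - c| / ε) :=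
    LocallyLipschitzOn.comp_of_lipschitz (g := fun s => clampUnit (2 - |s - c| / ε)) (L := 1 / ε)
      h.c11.locallyLipschitzOn fun a b => by
        refine (abs_clampUnit_sub_le _ _).trans ?_
        rw [show 2 - |a - c| / ε - (2 - |b - c| / ε) = (|b - c| - |a - c|) / ε by ring, abs_div,
          abs_of_pos hε, one_div_mul_eq_div]
        refine div_le_div_of_nonneg_right ?_ hε.le
        refine (abs_abs_sub_abs_le (b - c) (a - c)).trans (le_of_eq ?_)
        rw [sub_sub_sub_cancel_right, abs_sub_comm]
  have h2 : LocallyLipschitzOn M fun u =>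
      clampUnit (4 * (truncDist B M (criticalSetAt M Φ c) ρ u).toReal / ρ - 1) :=
    LocallyLipschitzOn.comp_of_lipschitz (g := fun s => clampUnit (4 * s / ρ - 1)) (L := 4 / ρ)
      (h.locallyLipschitzOn_toReal (truncDist_le_add _ _) fun u _ => truncDist_ne_top _ _ u)
      fun a b => by
        refine (abs_clampUnit_sub_le _ _).trans (le_of_eq ?_)
        rw [show 4 * a / ρ - 1 - (4 * b / ρ - 1) = 4 / ρ * (a - b) by ring, abs_mul,
          abs_of_pos (by positivity)]
  have hconst : ∀ r : ℝ, LocallyLipschitzOn M fun _ : X => r := fun r =>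
    (LocallyLipschitz.const r).locallyLipschitzOn
  have h3 : LocallyLipschitzOn M fun u => δ * (1 + (nFun B M u).toReal)⁻¹ := by
    refine LocallyLipschitzOn.mul_fun (hconst δ) (LocallyLipschitzOn.inv_fun ?_
      fun u _ => one_add_nFun_pos u)
    exact LocallyLipschitzOn.comp_of_lipschitz (g := fun s => 1 + s) (L := 1)
      (h.locallyLipschitzOn_toReal nFun_le_add fun u hu => nFun_ne_top hu) fun a b => by simp
  have h4 : LocallyLipschitzOn M (gradSqMax B M Φ δ) :=
    LocallyLipschitzOn.max_fun (h.locallyLipschitzOn_apply_self h.locallyLipschitzOn_gradOn)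
      (LocallyLipschitzOn.mul_fun h3 h3)
  exact LocallyLipschitzOn.mul_fun (LocallyLipschitzOn.mul_fun
    (LocallyLipschitzOn.mul_fun (hconst (2 * ε)) h1) h2)
    (LocallyLipschitzOn.inv_fun h4 fun u _ => gradSqMax_pos hδ u)

/-- The product of `g = ‖∇Φ‖` and `δ/(1+N)` is at most the maximum of their squares, which is the
denominator of `κ`. This is the linear growth in `N` required by `hasEndpoints`. -/
lemma flowFactor_mul_normAt_le (hδ : 0 < δ) (hε : 0 < ε) {u : X} (hu : u ∈ M) :
    |flowFactor B M Φ c ρ δ ε u| * normAt B u (gradOn B M Φ u) ≤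
      2 * ε / δ * (1 + (nFun B M u).toReal) := by
  rw [abs_of_nonneg (flowFactor_nonneg hδ hε u)]
  have h1 := clampUnit_nonneg (2 - |Φ u - c| / ε)
  have h1' := clampUnit_le_one (2 - |Φ u - c| / ε)
  have h2 := clampUnit_nonneg
    (4 * (truncDist B M (criticalSetAt M Φ c) ρ u).toReal / ρ - 1)
  have h2' := clampUnit_le_one
    (4 * (truncDist B M (criticalSetAt M Φ c) ρ u).toReal / ρ - 1)
  have h3 := gradSqMax_pos (B := B) (M := M) (Φ := Φ) hδ u
  have hN := one_add_nFun_pos (B := B) (M := M) u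
  have hg := normAt_nonneg B u (gradOn B M Φ u)
  unfold flowFactor
  set x := clampUnit (2 - |Φ u - c| / ε)
  set y := clampUnit (4 * (truncDist B M (criticalSetAt M Φ c) ρ u).toReal / ρ - 1)
  set n := 1 + (nFun B M u).toReal
  set g := normAt B u (gradOn B M Φ u) with hgdef
  have hq : g * (δ * n⁻¹) ≤ gradSqMax B M Φ δ u := by
    have e1 : g * g ≤ gradSqMax B M Φ δ u := by
      rw [← sq, hgdef, h.isScalarProductFamily.normAt_sq (h.ne_zero hu)]
      exact le_max_left _ _
    have e2 : δ * n⁻¹ * (δ * n⁻¹) ≤ gradSqMax B M Φ δ u := le_max_right _ _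
    nlinarith [sq_nonneg (g - δ * n⁻¹)]
  have hq' : (gradSqMax B M Φ δ u)⁻¹ * g ≤ n / δ := by
    rw [inv_mul_le_iff₀ h3, mul_comm, div_mul_eq_mul_div, le_div_iff₀ hδ, mul_comm n]
    have := mul_le_mul_of_nonneg_right hq hN.le
    calc g * δ = g * (δ * n⁻¹) * n := by field_simp
      _ ≤ _ := this
  calc 2 * ε * x * y * (gradSqMax B M Φ δ u)⁻¹ * g
      = 2 * ε * (x * y) * ((gradSqMax B M Φ δ u)⁻¹ * g) := by ring
    _ ≤ 2 * ε * (1 * 1) * (n / δ) := by gcongr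
    _ = 2 * ε / δ * n := by ring

lemma flowFactor_map [CompleteSpace X] {L : X ≃L[ℝ] X} (hL : IsSymmetry B M Φ L) {u : X}
    (hu : u ∈ M) : flowFactor B M Φ c ρ δ ε (L u) = flowFactor B M Φ c ρ δ ε u := by
  unfold flowFactor gradSqMax truncDist
  rw [hL.apply_map u hu, hL.distToSet_map h, hL.form_gradOn_map h hu, hL.nFun_map]

/-- The derivative of `Φ` along a flow line of `-κ ∇Φ`. -/
lemma hasDerivAt_along [CompleteSpace X] {κ : X → ℝ} {φ : X → ℝ → X}
    (hφ : IsGlobalFlow (fun u => -(κ u • gradOn B M Φ u)) M φ) {u : X} (hu : u ∈ M) (t : ℝ) :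
    HasDerivAt (fun t => Φ (φ u t))
      (-(κ (φ u t) * B (φ u t) (gradOn B M Φ (φ u t)) (gradOn B M Φ (φ u t)))) t := by
  have h1 := h.c11.hasDerivAt_comp (Eventually.of_forall fun s => hφ.mem hu s)
    (hφ.hasDerivAt hu t)
  have hg := h.isGradientAt_gradOn (hφ.mem hu t)
  rw [hg.2 _ (Submodule.neg_mem _ (Submodule.smul_mem _ _ hg.1))] at h1
  simpa using h1

lemma antitone_along [CompleteSpace X] {κ : X → ℝ} {φ : X → ℝ → X}
    (hφ : IsGlobalFlow (fun u => -(κ u • gradOn B M Φ u)) M φ) (hκ : ∀ u, 0 ≤ κ u) {u : X}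
    (hu : u ∈ M) : Antitone fun t => Φ (φ u t) := by
  refine antitone_of_deriv_nonpos (fun t => (h.hasDerivAt_along hφ hu t).differentiableAt)
    fun t => ?_
  rw [(h.hasDerivAt_along hφ hu t).deriv, neg_nonpos]
  exact mul_nonneg (hκ _) (h.isScalarProductFamily.self_nonneg (h.ne_zero (hφ.mem hu t)) _)

/-- Here both cut-offs equal `1` and the maximum in the denominator is `‖∇Φ‖²`, so everything
cancels: `Φ` decreases at the constant rate `2ε`. -/
lemma flowFactor_mul_form [CompleteSpace X] (hρ : 0 < ρ) (hδ : 0 < δ) (hε : 0 < ε) {u : X}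
    (hu : u ∈ M) (hΦu : |Φ u - c| ≤ ε)
    (hd : ρ / 2 ≤ (truncDist B M (criticalSetAt M Φ c) ρ u).toReal)
    (hlow : δ ≤ normAt B u (gradOn B M Φ u) * (1 + (nFun B M u).toReal)) :
    flowFactor B M Φ c ρ δ ε u * B u (gradOn B M Φ u) (gradOn B M Φ u) = 2 * ε := by
  have hN := one_add_nFun_pos (B := B) (M := M) u
  have h1 : clampUnit (2 - |Φ u - c| / ε) = 1 := by
    refine clampUnit_of_one_le ?_
    have : |Φ u - c| / ε ≤ 1 := (div_le_one hε).2 hΦu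
    linarith
  have h2 : clampUnit (4 * (truncDist B M (criticalSetAt M Φ c) ρ u).toReal / ρ - 1) = 1 := by
    refine clampUnit_of_one_le ?_
    rw [le_sub_iff_add_le, le_div_iff₀ hρ]
    linarith
  have hg : δ * (1 + (nFun B M u).toReal)⁻¹ ≤ normAt B u (gradOn B M Φ u) := by
    rwa [← div_eq_mul_inv, div_le_iff₀ hN]
  have hgp : 0 < δ * (1 + (nFun B M u).toReal)⁻¹ := by positivity
  have hsq := h.isScalarProductFamily.normAt_sq (h.ne_zero hu) (gradOn B M Φ u)
  have h3 : gradSqMax B M Φ δ u = B u (gradOn B M Φ u) (gradOn B M Φ u) := by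
    refine max_eq_left ?_
    rw [← hsq, sq]
    exact mul_self_le_mul_self hgp.le hg
  have h4 : B u (gradOn B M Φ u) (gradOn B M Φ u) ≠ 0 := by
    rw [← h3]; exact (gradSqMax_pos hδ u).ne'
  unfold flowFactor
  rw [h1, h2, h3, mul_assoc, inv_mul_cancel₀ h4]
  ring

/-- A flow line that starts outside `A_{c,ρ}` does not come closer than `ρ/2` to `K_c` within unit
time. -/
lemma half_le_truncDist_along [CompleteSpace X] (hρ : 0 < ρ) (hδ : 0 < δ) (hε : 0 < ε)
    {R : ℝ} (hR : 0 < R) (hRK : ∀ u ∈ criticalSetAt M Φ c, (nFun B M u).toReal ≤ R)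
    (hεR : 2 * ε / δ * (1 + (R + ρ)) < ρ / 2) {φ : X → ℝ → X}
    (hφ : IsGlobalFlow (fun u => -(flowFactor B M Φ c ρ δ ε u • gradOn B M Φ u)) M φ) {u : X}
    (hu : u ∈ M) (hfar : u ∉ criticalNhd B M Φ c ρ) {t : ℝ} (ht : t ∈ Icc (0 : ℝ) 1) :
    ρ / 2 ≤ (truncDist B M (criticalSetAt M Φ c) ρ (φ u t)).toReal := by
  by_contra! hlt
  set f : ℝ → ℝ := fun s => (truncDist B M (criticalSetAt M Φ c) ρ (φ u s)).toReal with hf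
  have hfc : Continuous f := by
    have h1 := (h.locallyLipschitzOn_toReal (truncDist_le_add (criticalSetAt M Φ c) ρ)
      fun u _ => truncDist_ne_top _ _ u).continuousOn.comp (hφ.continuous hu).continuousOn
      (s := univ) fun s _ => hφ.mem hu s
    exact continuousOn_univ.1 h1
  have hf0 : ρ ≤ f 0 := by
    simp only [hf, hφ.apply_zero u hu]
    rw [le_toReal_truncDist_iff le_rfl]
    by_contra! hcon
    exact hfar ⟨hu, hcon⟩
  -- `s` is the last time before `t` with distance at least `ρ`. Afterwards the line is within `ρ`
  -- of `K_c`, so `N ≤ R + ρ` and the speed is bounded.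
  obtain ⟨s, ⟨hs, hsρ⟩, hmax⟩ := (isCompact_Icc.inter_right
    (isClosed_Ici.preimage hfc)).exists_isMaxOn (s := Icc 0 t ∩ f ⁻¹' Ici ρ)
    ⟨0, left_mem_Icc.2 ht.1, hf0⟩ continuousOn_id
  have hsρ : ρ ≤ f s := hsρ
  have hst : s < t := by
    refine hs.2.lt_of_ne fun heq => ?_
    rw [heq] at hsρ
    have : f t < ρ / 2 := hlt
    linarith
  have hin : ∀ r ∈ Ioc s t, f r < ρ := fun r hr => by
    by_contra! hcon
    exact absurd (hmax (⟨⟨hs.1.trans hr.1.le, hr.2⟩, hcon⟩ : r ∈ Icc 0 t ∩ f ⁻¹' Ici ρ))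
      (not_le.2 hr.1)
  have hN : ∀ r ∈ Ioc s t, (nFun B M (φ u r)).toReal ≤ R + ρ := fun r hr => by
    have h1 : distToSet B M (φ u r) (criticalSetAt M Φ c) < ENNReal.ofReal ρ := by
      have := hin r hr
      rw [← not_le, le_toReal_truncDist_iff le_rfl, not_le] at this
      exact this
    simp only [distToSet, iInf_lt_iff] at h1
    obtain ⟨a, ha, hda⟩ := h1
    rw [lengthDist_comm] at hda
    have := toReal_le_toReal_add nFun_le_add (nFun_ne_top ha.1.1) hρ.le hda.le
    linarith [hRK a ha]
  have hdist : ∀ r ∈ Ioc s t, f r ≤ f t + 2 * ε / δ * (1 + (R + ρ)) := fun r hr => by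
    have hsub : uIcc t r ⊆ Ioc s t := by
      rw [uIcc_of_ge hr.2]
      exact fun q hq => ⟨hr.1.trans_le hq.1, hq.2⟩
    have hd := (hφ.isFlowLine u hu).lengthDist_le (B := B) hφ.locallyLipschitzOn
      (s := t) (t := r) (L := 2 * ε / δ * (1 + (R + ρ))) (subset_univ _) fun q hq => by
        rw [normAt_neg, normAt_smul]
        refine (h.flowFactor_mul_normAt_le hδ hε (hφ.mem hu q)).trans ?_
        gcongr
        exact hN q (hsub hq)
    have hd' := toReal_le_toReal_add (truncDist_le_add (criticalSetAt M Φ c) ρ)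
      (truncDist_ne_top _ _ _) (by positivity) hd
    have habs : |r - t| ≤ 1 := by
      rw [abs_le]
      constructor <;> linarith [hr.1, hr.2, hs.1, ht.2]
    have : 2 * ε / δ * (1 + (R + ρ)) * |r - t| ≤ 2 * ε / δ * (1 + (R + ρ)) :=
      mul_le_of_le_one_right (by positivity) habs
    change f r ≤ f t + _ at hd'
    linarith
  -- The speed bound holds only for times after `s`; the estimate reaches `s` by continuity. With `f
  -- s ≥ ρ` and `f t < ρ/2` it contradicts `hεR`.
  have hlim : f s ≤ f t + 2 * ε / δ * (1 + (R + ρ)) := by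
    refine le_of_tendsto (hfc.continuousAt.mono_left nhdsWithin_le_nhds : Tendsto f (𝓝[>] s) _) ?_
    filter_upwards [Ioc_mem_nhdsGT hst] with r hr using hdist r hr
  have : f t < ρ / 2 := hlt
  linarith

/-- If the value at time one exceeded `c - ε`, monotonicity would keep `Φ` within `ε` of `c` on all
of `[0,1]`. The rate `-2ε` would then hold throughout, giving a total drop of `2ε` from at most `c +
ε`. -/
lemma apply_flow_one_le [CompleteSpace X] (hρ : 0 < ρ) (hδ : 0 < δ) (hε : 0 < ε)
    (hlow : ∀ u ∈ M, |Φ u - c| ≤ ε →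
      ENNReal.ofReal (ρ / 2) ≤ distToSet B M u (criticalSetAt M Φ c) →
      δ ≤ normAt B u (gradOn B M Φ u) * (1 + (nFun B M u).toReal))
    {R : ℝ} (hR : 0 < R) (hRK : ∀ u ∈ criticalSetAt M Φ c, (nFun B M u).toReal ≤ R)
    (hεR : 2 * ε / δ * (1 + (R + ρ)) < ρ / 2) {φ : X → ℝ → X}
    (hφ : IsGlobalFlow (fun u => -(flowFactor B M Φ c ρ δ ε u • gradOn B M Φ u)) M φ) {u : X}
    (hu : u ∈ M) (hΦu : Φ u ≤ c + ε) (hfar : u ∉ criticalNhd B M Φ c ρ) :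
    Φ (φ u 1) ≤ c - ε := by
  by_contra! hcon
  have hanti := h.antitone_along hφ (fun u => flowFactor_nonneg hδ hε u) hu
  have hd : ∀ t ∈ Icc (0 : ℝ) 1, HasDerivAt (fun t => Φ (φ u t)) (-(2 * ε)) t := fun t ht => by
    have h1 := h.hasDerivAt_along hφ hu t
    have hfart := h.half_le_truncDist_along hρ hδ hε hR hRK hεR hφ hu hfar ht
    have hΦt : |Φ (φ u t) - c| ≤ ε := by
      have e1 : Φ (φ u t) ≤ Φ (φ u 0) := hanti ht.1
      have e2 : Φ (φ u 1) ≤ Φ (φ u t) := hanti ht.2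
      rw [hφ.apply_zero u hu] at e1
      rw [abs_le]
      constructor <;> linarith
    rwa [h.flowFactor_mul_form hρ hδ hε (hφ.mem hu t) hΦt hfart (hlow _ (hφ.mem hu t) hΦt
      ((le_toReal_truncDist_iff (by linarith)).1 hfart))] at h1
  obtain ⟨s, -, hs⟩ := exists_hasDerivAt_eq_slope (fun t => Φ (φ u t)) (fun _ => -(2 * ε))
    zero_lt_one (fun t ht => (hd t ht).continuousAt.continuousWithinAt)
    fun t ht => hd t (Ioo_subset_Icc_self ht)
  rw [hφ.apply_zero u hu] at hs
  simp only [sub_zero, div_one] at hs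
  linarith

end IsGradientSetting
end FlowFactor

/-- The element `g` of the group, as a symmetry. -/
lemma IsGradientSetting.exists_symmetry_smul {G : Type*} [Group G] [DistribMulAction G X]
    [SMulCommClass G ℝ X] (h : IsGradientSetting B M Φ) (hne : M.Nonempty)
    (hB_inv : ∀ u : X, u ≠ 0 → ∀ (g : G) (v w : X), B (g • u) (g • v) (g • w) = B u v w)
    (hM_inv : ∀ (g : G), ∀ u ∈ M, g • u ∈ M) (hΦ_inv : ∀ (g : G), ∀ u ∈ M, Φ (g • u) = Φ u)
    (g : G) : ∃ L : X ≃L[ℝ] X, IsSymmetry B M Φ L ∧ ∀ x, L x = g • x := by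
  obtain ⟨u, hu⟩ := hne
  -- Continuity of `v ↦ g • v` is not assumed: it follows because the map is an isometry from
  -- `‖·‖_u` to `‖·‖_{g • u}`, both equivalent to the norm of `X`.
  have hbound : ∀ g : G, ∃ C : ℝ, ∀ v : X, ‖g • v‖ ≤ C * ‖v‖ := fun g => by
    obtain ⟨U, hU, -, C, hC, hUC⟩ := h.equivalent u (h.ne_zero hu)
    obtain ⟨U', hU', -, C', hC', hUC'⟩ := h.equivalent (g • u) (h.ne_zero (hM_inv g u hu))
    refine ⟨C' * C, fun v => ?_⟩
    have h1 := (hUC' _ (mem_of_mem_nhds hU') (g • v)).1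
    rw [one_div, inv_mul_le_iff₀ hC'] at h1
    have h2 : normAt B (g • u) (g • v) = normAt B u v := by
      unfold normAt; rw [hB_inv u (h.ne_zero hu)]
    rw [h2] at h1
    refine h1.trans ?_
    rw [mul_assoc]
    gcongr
    exact (hUC _ (mem_of_mem_nhds hU) v).2
  obtain ⟨C, hC⟩ := hbound g
  obtain ⟨C', hC'⟩ := hbound g⁻¹
  refine ⟨(DistribMulAction.toLinearEquiv ℝ X g).toContinuousLinearEquivOfBounds C C' hC hC',
    ⟨hM_inv g, hM_inv g⁻¹, fun u hu => hB_inv u (h.ne_zero hu) g, hΦ_inv g⟩, fun x => rfl⟩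

end NCerami
end

/-! ### The deformation theorem -/

theorem mainTheorem8
    {X : Type*} [NormedAddCommGroup X] [InnerProductSpace ℝ X] [CompleteSpace X]
    {G : Type*} [Group G] [TopologicalSpace G] [IsTopologicalGroup G]
    [DistribMulAction G X] [SMulCommClass G ℝ X]
    -- the family of scalar products
    (B : X → LinearMap.BilinForm ℝ X)
    (hB : NCerami.IsScalarProductFamily B)
    (hB_equiv : NCerami.LocallyUniformlyEquivalent B)
    (hB_lip : NCerami.LocallyLipschitzFamily B)
    (hB_inv : ∀ u : X, u ≠ 0 → ∀ (g : G) (v w : X), B (g • u) (g • v) (g • w) = B u v w)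
    -- the symmetric, invariant submanifold
    (M : Set X) (hM : NCerami.IsC11Submanifold M) (hM_zero : (0 : X) ∉ M)
    (hM_neg : ∀ u ∈ M, -u ∈ M) (hM_inv : ∀ (g : G), ∀ u ∈ M, g • u ∈ M)
    (hB_even : ∀ u ∈ M, ∀ v w : X, B (-u) v w = B u v w)
    -- the even, invariant functional
    (Φ : X → ℝ) (hΦ : NCerami.IsC11FunctionOn M Φ)
    (hΦ_even : ∀ u ∈ M, Φ (-u) = Φ u) (hΦ_inv : ∀ (g : G), ∀ u ∈ M, Φ (g • u) = Φ u)
    (c ε₀ : ℝ) (hε₀ : 0 < ε₀)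
    (hcomplete : NCerami.IsLengthComplete B M {u | u ∈ M ∧ Φ u ∈ Icc (c - 2 * ε₀) (c + 2 * ε₀)})
    (hNCG : NCerami.NCGCondition G B M Φ c)
    (ρ : ℝ) (hρ : 0 < ρ) :
    ∃ ε : ℝ, 0 < ε ∧ ε < ε₀ ∧ ∃ η : unitInterval × M → M, Continuous η ∧
      (∀ (t : unitInterval) (u : M),
        t = 0 ∨ Φ u ∉ Icc (c - 2 * ε) (c + 2 * ε) → η (t, u) = u) ∧
      (∀ t : unitInterval, IsHomeomorph (fun u : M => η (t, u))) ∧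
      (∀ (t : unitInterval) (u : M), (η (t, ⟨-u, hM_neg u u.2⟩) : X) = -(η (t, u) : X)) ∧
      (∀ u : M, Φ u ≤ c + ε → (u : X) ∉ NCerami.criticalNhd B M Φ c ρ →
        Φ (η (1, u)) ≤ c - ε) ∧
      (∀ u : M, Antitone fun t : unitInterval => Φ (η (t, u))) ∧
      (∀ (t : unitInterval) (g : G) (u : M),
        (η (t, ⟨g • (u : X), hM_inv g u u.2⟩) : X) = g • (η (t, u) : X)) := by
  have h : NCerami.IsGradientSetting B M Φ := ⟨hB, hB_equiv, hB_lip, hM, hM_zero, hΦ⟩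
  -- A point of `M` is needed to see that the group acts by bounded operators; for empty `M` the
  -- claim is trivial.
  rcases M.eq_empty_or_nonempty with rfl | hne
  · refine ⟨ε₀ / 2, by positivity, by linarith, Prod.snd, continuous_snd, fun _ _ _ => rfl,
      fun t => IsHomeomorph.id, fun t u => u.2.elim, fun u => u.2.elim, fun u => u.2.elim,
      fun t g u => u.2.elim⟩
  have hsym := h.exists_symmetry_smul hne hB_inv hM_inv hΦ_inv
  -- With `-id` as a symmetry, oddness becomes a case of equivariance.
  have hneg : NCerami.IsSymmetry B M Φ (ContinuousLinearEquiv.neg ℝ) :=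
    ⟨hM_neg, hM_neg, fun u hu v w => by simpa using hB_even u hu v w, hΦ_even⟩
  obtain ⟨ε₁, hε₁, δ, hδ, hlow⟩ := h.exists_cerami_lower_bound hsym hNCG (half_pos hρ)
  obtain ⟨R, hR, hRK⟩ := h.exists_nFun_le hsym hNCG
  obtain ⟨ε, hε, hεε₀, hεε₁, hεR⟩ : ∃ ε : ℝ, 0 < ε ∧ ε < ε₀ ∧ ε ≤ ε₁ ∧
      2 * ε / δ * (1 + (R + ρ)) < ρ / 2 := by
    have hpos : 0 < ρ * δ / (8 * (1 + (R + ρ))) := by positivity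
    -- The last entry limits the distance travelled near `K_c` in unit time to `ρ / 4`.
    refine ⟨min (min (ε₀ / 2) ε₁) (ρ * δ / (8 * (1 + (R + ρ)))),
      lt_min (lt_min (by positivity) hε₁) hpos, ?_, ?_, ?_⟩
    · exact ((min_le_left _ _).trans (min_le_left _ _)).trans_lt (by linarith)
    · exact (min_le_left _ _).trans (min_le_right _ _)
    · calc _ ≤ 2 * (ρ * δ / (8 * (1 + (R + ρ)))) / δ * (1 + (R + ρ)) := by
            gcongr; exact min_le_right _ _
        _ = ρ / 4 := by field_simp; norm_num
        _ < ρ / 2 := by linarith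
  set κ := NCerami.flowFactor B M Φ c ρ δ ε with hκ
  obtain ⟨φ, hφ, hloc⟩ := h.exists_isGlobalFlow
    (h.locallyLipschitzOn_flowFactor (c := c) hρ hδ hε) (A := 2 * ε / δ) (by positivity)
    (fun u hu => h.flowFactor_mul_normAt_le hδ hε hu) hcomplete fun u _ hI =>
      NCerami.flowFactor_eq_zero hε fun hI' => hI ⟨by linarith [hI'.1], by linarith [hI'.2]⟩
  have hcont := hφ.continuousOn hloc
  have hcont' : ∀ {Y : Type _} [TopologicalSpace Y] {f : Y → X} {τ : Y → ℝ}, Continuous f →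
      Continuous τ → (∀ y, f y ∈ M) → Continuous fun y => φ (f y) (τ y) := by
    intro Y _ f τ hf hτ hfM
    have := hcont.comp_continuous (hf.prodMk hτ) fun y => ⟨hfM y, trivial⟩
    exact this
  have hequiv : ∀ L : X ≃L[ℝ] X, NCerami.IsSymmetry B M Φ L → ∀ u ∈ M, ∀ t,
      φ (L u) t = L (φ u t) := fun L hL u hu t =>
    hφ.map_eq (L := L.toContinuousLinearMap) hL.map_mem (fun x hx => by
      change -(κ (L x) • NCerami.gradOn B M Φ (L x)) = L (-(κ x • NCerami.gradOn B M Φ x))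
      rw [hκ, h.flowFactor_map hL hx, hL.gradOn_map h hx, map_neg, map_smul]) hu t
  refine ⟨ε, hε, hεε₀, fun p => ⟨φ p.2 p.1, hφ.mem p.2.2 _⟩, ?_, ?_, ?_, ?_, ?_, ?_, ?_⟩
  · exact (hcont' (by fun_prop) (by fun_prop) fun p => p.2.2).subtype_mk _
  · rintro t u (rfl | hu)
    · exact Subtype.ext (hφ.apply_zero u u.2)
    · refine Subtype.ext ?_
      have hz := hφ.eq_of_field_eq_zero u.2 (s := 0) (by
        rw [hφ.apply_zero u u.2]
        change -(κ u • _) = 0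
        rw [hκ, NCerami.flowFactor_eq_zero hε hu, zero_smul, neg_zero]) t
      rw [hφ.apply_zero u u.2] at hz
      exact hz
  · intro t
    -- By the group law the time `-t` map, which lies outside the range of `η`, inverts the time `t`
    -- map.
    have hinv : ∀ (s : ℝ) (u : M), φ (φ u s) (-s) = u := fun s u => by
      have := hφ.apply_add u.2 s 0
      rwa [zero_sub, hφ.apply_zero u u.2] at this
    exact (Homeomorph.mk
      ⟨fun u : M => (⟨φ u t, hφ.mem u.2 _⟩ : M), fun u : M => (⟨φ u (-t), hφ.mem u.2 _⟩ : M),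
        fun u => Subtype.ext (hinv t u), fun u => Subtype.ext (by simpa using hinv (-t) u)⟩
      ((hcont' continuous_subtype_val continuous_const fun u => u.2).subtype_mk _)
      ((hcont' continuous_subtype_val continuous_const fun u => u.2).subtype_mk _)).isHomeomorph
  · intro t u
    exact hequiv _ hneg u u.2 t
  · intro u hu hfar
    exact h.apply_flow_one_le hρ hδ hε (fun v hv hv' => hlow v hv (hv'.trans hεε₁)) hR hRK hεR hφ
      u.2 hu hfar
  · intro u s t hst
    exact h.antitone_along hφ (fun v => NCerami.flowFactor_nonneg hδ hε v) u.2 hst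
  · intro t g u
    obtain ⟨L, hL, hLg⟩ := hsym g
    have := hequiv L hL u u.2 t
    rw [hLg, hLg] at this
    exact this
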